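/- Let $\Gamma$ be a countable infinite connected graph with symmetric weights $\mu_{x,y}=\mu_{y,x}$, positive exactly on the edges $x\sim y$, and such that $\mu(x)=\sum_{y\sim x}\mu_{x,y}<\infty$ for every vertex $x$. Put $\mu(A)=\sum_{y\in A}\mu(y)$ for $A\subset\Gamma$, and $P(x,y)=\mu_{x,y}/\mu(x)$. Let $(X_n)$ be the Markov chain (random walk) with transition probabilities $P(x,y)$, let $Pf(x)=\sum_y P(x,y)f(y)$ and $\Delta=P-I$. Let $d$ be the graph distance, $B(x,R)=\{y: d(x,y)<R\}$ for real $R>0$, $V(x,R)=\mu(B(x,R))$ and $v(x,r,R)=V(x,R)-V(x,r)$. Let $E(x,R)=\mathbb E(T_{B(x,R)}\mid X_0=x)$, where $T_A=\min\{k: X_k\notin A\}$ is the exit time from $A$. For disjoint $A,B\subset\Gamma$ the resistance is $$\rho(A,B)=\Bigl(\inf\bigl\{(-\Delta f,f)_\mu : f \text{ finitely supported},\ f|_A=1,\ f|_B=0\bigr\}\Bigr)^{-1},\qquad (f,g)_\mu=\sum_x f(x)g(x)\mu(x),$$ and $\rho(x,r,R)=\rho(B(x,r),\Gamma\setminus B(x,R))$.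 Suppose that the following conditions hold. * $(p_0)$: there is $p_0>0$ such that $\mu_{x,y}/\mu(x)\ge p_0$ for all $x\sim y$. * $(VD)$: there is $D_V>0$ such that $V(x,2R)\le D_V V(x,R)$ for all $x\in\Gamma$ and $R>0$. * $(H)$: there is $H>1$ such that for all $x\in\Gamma$, $R>0$ and every non-negative function $u$ that is harmonic in $B(x,2R)$ (that is, $Pu=u$ on $B(x,2R)$), $\max_{B(x,R)}u\le H\min_{B(x,R)}u$. * Anti-doubling of $\rho v$: there is $A>1$ such that for all $x\in\Gamma$ and $R>0$, $$\rho(x,AR,2AR)\,v(x,AR,2AR)\ \ge\ 2\,\rho(x,R,2R)\,v(x,R,2R).$$ Then $E(x,2R)\simeq\rho(x,R,2R)\,v(x,R,2R)$: there is a constant $C>1$ such that for all $x\in\Gamma$ and all real $R>\tfrac12$, $$C^{-1}E(x,2R)\ \le\ \rho(x,R,2R)\,v(x,R,2R)\ \le\ C\,E(x,2R).$$ -/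

import Mathlib

open MeasureTheory ProbabilityTheory
open scoped ENNReal

/-- The simple graph that joins two distinct points `x`, `y` when the symmetric weight `w x y` is
positive. It carries the shortest-path distance (loops play no role for the distance). -/
def weightAdjacency {V : Type*} (w : V → V → ℝ) : SimpleGraph V :=
  SimpleGraph.fromRel fun x y => 0 < w x y

/-- A connected weighted graph `(Γ, μ)` on the vertex set `V`: the edges `x ∼ y` are the pairs with
`0 < w x y`, and `w x y = w y x` is the weight `μ_{x,y}` of the edge. The vertex weights
`μ(x) = ∑_y μ_{x,y}` are finite. A positive diagonal weight is a loop. -/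
structure WeightedGraph (V : Type*) where
  w : V → V → ℝ
  symm : ∀ x y, w x y = w y x
  nonneg : ∀ x y, 0 ≤ w x y
  summable : ∀ x, Summable (w x)
  connected : (weightAdjacency w).Connected

namespace WeightedGraph

variable {V : Type*} (Γ : WeightedGraph V)

/-- `x ∼ y`. -/
def Edge (x y : V) : Prop := 0 < Γ.w x y

/-- The shortest-path distance `d(x, y)`. -/
noncomputable def dist (x y : V) : ℕ := (weightAdjacency Γ.w).dist x y

/-- The vertex weight `μ(x) = ∑_{y ∼ x} μ_{x,y}`. -/
noncomputable def mu (x : V) : ℝ := ∑' y, Γ.w x y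

/-- The measure `μ(A) = ∑_{y ∈ A} μ(y)` of a vertex set. -/
noncomputable def vol (A : Set V) : ℝ≥0∞ := ∑' y : A, ENNReal.ofReal (Γ.mu y)

/-- The open ball `B(x, R) = {y : d(x, y) < R}`. -/
def ball (x : V) (R : ℝ) : Set V := {y | (Γ.dist x y : ℝ) < R}

/-- `V(x, R) = μ(B(x, R))`. -/
noncomputable def ballVol (x : V) (R : ℝ) : ℝ≥0∞ := Γ.vol (Γ.ball x R)

/-- `v(x, r, R) = V(x, R) - V(x, r)`. -/
noncomputable def annulusVol (x : V) (r R : ℝ) : ℝ≥0∞ := Γ.ballVol x R - Γ.ballVol x r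

/-- The transition probability `P(x, y) = μ_{x,y} / μ(x)`. -/
noncomputable def P (x y : V) : ℝ := Γ.w x y / Γ.mu x

/-- The Markov operator `P f (x) = ∑_y P(x, y) f(y)`. -/
noncomputable def markov (f : V → ℝ) (x : V) : ℝ := ∑' y, Γ.P x y * f y

/-- The Laplace operator `Δ = P - I`. -/
noncomputable def laplace (f : V → ℝ) (x : V) : ℝ := Γ.markov f x - f x

/-- The inner product `(f, g) = ∑_x f(x) g(x) μ(x)`, used when `f` or `g` has finite support. -/
noncomputable def innerMu (f g : V → ℝ) : ℝ := ∑' x, f x * g x * Γ.mu x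

/-- The resistance between `A` and `B`: the reciprocal of the infimum of the Dirichlet energy
`(-Δ f, f)` over the finitely supported `f` with `f = 1` on `A` and `f = 0` on `B`. -/
noncomputable def resistance (A B : Set V) : ℝ≥0∞ :=
  (⨅ (f : V →₀ ℝ) (_ : ∀ x ∈ A, f x = 1) (_ : ∀ x ∈ B, f x = 0),
    ENNReal.ofReal (Γ.innerMu (fun x => - Γ.laplace f x) f))⁻¹

/-- `ρ(x, r, R)`, the resistance between `B(x, r)` and the complement of `B(x, R)`. -/
noncomputable def annulusRes (x : V) (r R : ℝ) : ℝ≥0∞ :=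
  Γ.resistance (Γ.ball x r) (Γ.ball x R)ᶜ

/-- The condition `(p₀)`. -/
def CondP0 : Prop := ∃ p₀ : ℝ, 0 < p₀ ∧ ∀ x y, Γ.Edge x y → p₀ ≤ Γ.w x y / Γ.mu x

/-- Volume doubling `(VD)`. -/
def VolumeDoubling : Prop :=
  ∃ D : ℝ, 0 < D ∧ ∀ (x : V) (R : ℝ), 0 < R →
    Γ.ballVol x (2 * R) ≤ ENNReal.ofReal D * Γ.ballVol x R

/-- `u` is harmonic on `A`. -/
def HarmonicOn (u : V → ℝ) (A : Set V) : Prop := ∀ x ∈ A, Γ.markov u x = u x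

/-- The elliptic Harnack inequality `(H)`. Harmonicity on a ball only involves the values of `u` on
the ball and at the neighbours of its points, so that `u` may be taken to be zero elsewhere. -/
def EllipticHarnack : Prop :=
  ∃ H : ℝ, 1 < H ∧ ∀ (x : V) (R : ℝ), 0 < R → ∀ u : V → ℝ, (∀ y, 0 ≤ u y) →
    Γ.HarmonicOn u (Γ.ball x (2 * R)) →
    ∀ y ∈ Γ.ball x R, ∀ z ∈ Γ.ball x R, u y ≤ H * u z

/-- The anti-doubling property of `ρ v`. -/
def AntiDoublingResVol : Prop :=
  ∃ A : ℝ, 1 < A ∧ ∀ (x : V) (R : ℝ), 0 < R →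
    2 * (Γ.annulusRes x R (2 * R) * Γ.annulusVol x R (2 * R)) ≤
      Γ.annulusRes x (A * R) (2 * (A * R)) * Γ.annulusVol x (A * R) (2 * (A * R))

theorem mu_pos [Nontrivial V] (x : V) : 0 < Γ.mu x := by
  obtain ⟨y, hy⟩ := Γ.connected.preconnected.exists_adj_of_nontrivial x
  have hw : 0 < Γ.w x y := by
    rcases (SimpleGraph.fromRel_adj _ _ _).1 hy with ⟨-, h | h⟩
    · exact h
    · rw [Γ.symm]; exact h
  exact (Γ.summable x).tsum_pos (Γ.nonneg x) y hw

theorem hasSum_P [Nontrivial V] (x : V) : HasSum (fun y => ENNReal.ofReal (Γ.P x y)) 1 := by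
  have h : HasSum (Γ.P x) 1 := by
    have := (Γ.summable x).hasSum.div_const (Γ.mu x)
    rwa [show (∑' y, Γ.w x y) = Γ.mu x from rfl, div_self (Γ.mu_pos x).ne'] at this
  have h0 : ∀ y, 0 ≤ Γ.P x y := fun y => div_nonneg (Γ.nonneg x y) (Γ.mu_pos x).le
  rw [← ENNReal.ofReal_one, ← h.tsum_eq, ENNReal.ofReal_tsum_of_nonneg h0 h.summable]
  exact ENNReal.summable.hasSum

/-- The law `P(x, ·)` of one step of the random walk from `x`. -/
noncomputable def stepPMF [Nontrivial V] (x : V) : PMF V :=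
  ⟨fun y => ENNReal.ofReal (Γ.P x y), Γ.hasSum_P x⟩

variable [MeasurableSpace V] [DiscreteMeasurableSpace V]

/-- The transition from the history `(X_0, …, X_n)` to `X_{n+1}`: a step from `X_n`. -/
noncomputable def stepKernel [Nontrivial V] [Countable V] (n : ℕ) :
    Kernel (Finset.Iic n → V) V :=
  (Kernel.ofFunOfCountable fun x => (Γ.stepPMF x).toMeasure).comap
    (fun h => h ⟨n, Finset.mem_Iic.2 le_rfl⟩) (measurable_pi_apply _)

instance [Nontrivial V] [Countable V] (n : ℕ) : IsMarkovKernel (Γ.stepKernel n) :=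
  ⟨fun h => inferInstanceAs
    (IsProbabilityMeasure (Γ.stepPMF (h ⟨n, Finset.mem_Iic.2 le_rfl⟩)).toMeasure)⟩

/-- The law on path space `ℕ → V` of the random walk `(X_n)` started at `X_0 = x`. -/
noncomputable def walkLaw [Nontrivial V] [Countable V] (x : V) : Measure (ℕ → V) :=
  Kernel.trajMeasure (X := fun _ => V) (Measure.dirac x) Γ.stepKernel

/-- The exit time `T_A = min {k : X_k ∉ A}` of a path (`∞` if the path never leaves `A`). -/
noncomputable def exitTime {V : Type*} (A : Set V) (X : ℕ → V) : ℝ≥0∞ :=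
  ⨅ (k : ℕ) (_ : X k ∉ A), (k : ℝ≥0∞)

/-- The mean exit time `E_z(A) = 𝔼(T_A | X_0 = z)`. -/
noncomputable def meanExit [Nontrivial V] [Countable V] (z : V) (A : Set V) : ℝ≥0∞ :=
  ∫⁻ X, exitTime A X ∂(Γ.walkLaw z)

/-- `E(x, R) = E_x(B(x, R))`. -/
noncomputable def E [Nontrivial V] [Countable V] (x : V) (R : ℝ) : ℝ≥0∞ :=
  Γ.meanExit x (Γ.ball x R)

end WeightedGraph

/-!
Let `g^D(x, ·)` be the Green function of the walk killed on leaving a ball `D = B(x, 2R)`. It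
reproduces point values through the Dirichlet form, `(-Δ g^D(x, ·), f)_μ = f(x)`, so its truncations
are admissible in the variational definition of the resistance, and `ρ(x, R, 2R)` lies between the
minimum of `g^D(x, ·)` over `B(x, R)` and its maximum over the annulus. The Harnack inequality along
chains of balls that avoid the pole, together with `(p₀)` at small scales, makes these comparable.

The mean exit time is the integral of the Green function, `E(x, 2R) = ∑_y g^D(x, y) μ(y)`, and
doubling gives `v(x, R, 2R) ≃ V(x, 2R)`. Restricting the sum to `B(x, R)` yields `ρ v ≤ C E`. In the
other direction the maximum principle gives `E(x, 2R) ≤ E(x, 2R/A) + M ρ v(x, R)`, and under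
anti-doubling the iterated error terms are dominated by a geometric series.
-/

namespace WeightedGraph

open scoped NNReal

section Distance

variable {V : Type*} {Γ : WeightedGraph V} {x y z : V}

theorem Edge.symm (h : Γ.Edge x y) : Γ.Edge y x := by
  rwa [Edge, Γ.symm]

theorem w_eq_zero_of_not_edge (h : ¬ Γ.Edge x y) : Γ.w x y = 0 :=
  le_antisymm (not_lt.1 h) (Γ.nonneg x y)

theorem adj_iff : (weightAdjacency Γ.w).Adj x y ↔ x ≠ y ∧ Γ.Edge x y := by
  rw [weightAdjacency, SimpleGraph.fromRel_adj, Γ.symm y x, or_self, Edge]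

@[simp]
theorem dist_self (x : V) : Γ.dist x x = 0 := SimpleGraph.dist_self

theorem dist_comm (x y : V) : Γ.dist x y = Γ.dist y x := SimpleGraph.dist_comm

theorem dist_triangle (x y z : V) : Γ.dist x z ≤ Γ.dist x y + Γ.dist y z :=
  Γ.connected.dist_triangle

theorem dist_eq_zero : Γ.dist x y = 0 ↔ x = y :=
  Γ.connected.dist_eq_zero_iff

theorem Edge.dist_le_one (h : Γ.Edge x y) : Γ.dist x y ≤ 1 := by
  rcases eq_or_ne x y with rfl | hxy
  · simp
  · exact (SimpleGraph.dist_eq_one_iff_adj.2 (adj_iff.2 ⟨hxy, h⟩)).le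

theorem Edge.dist_le_succ (h : Γ.Edge y z) (x : V) : Γ.dist x z ≤ Γ.dist x y + 1 :=
  (dist_triangle x y z).trans (Nat.add_le_add_left h.dist_le_one _)

theorem dist_le_sub_of_edge {γ : ℕ → V} {s t : ℕ} (hst : s ≤ t)
    (hγ : ∀ i, s ≤ i → i < t → Γ.Edge (γ i) (γ (i + 1))) : Γ.dist (γ s) (γ t) ≤ t - s := by
  induction t, hst using Nat.le_induction with
  | base => simp
  | succ t hst ih =>
    have := (hγ t hst t.lt_succ_self).dist_le_succ (γ s)
    have := ih fun i hsi hit => hγ i hsi (hit.trans t.lt_succ_self)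
    omega

/-- `γ` runs along a shortest path from `x` to `y` during the times `0, …, d(x, y)`; its later
values are irrelevant. -/
structure IsGeodesic (Γ : WeightedGraph V) (γ : ℕ → V) (x y : V) : Prop where
  edge : ∀ t < Γ.dist x y, Γ.Edge (γ t) (γ (t + 1))
  dist_left : ∀ t ≤ Γ.dist x y, Γ.dist x (γ t) = t
  right : γ (Γ.dist x y) = y

theorem IsGeodesic.left {γ : ℕ → V} (hγ : Γ.IsGeodesic γ x y) : γ 0 = x :=
  (dist_eq_zero.1 (hγ.dist_left 0 (Nat.zero_le _))).symm

theorem IsGeodesic.dist_le_sub {γ : ℕ → V} (hγ : Γ.IsGeodesic γ x y) {s t : ℕ} (hst : s ≤ t)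
    (ht : t ≤ Γ.dist x y) : Γ.dist (γ s) (γ t) ≤ t - s :=
  dist_le_sub_of_edge hst fun i _ hit => hγ.edge i (hit.trans_le ht)

theorem exists_isGeodesic (Γ : WeightedGraph V) (x y : V) : ∃ γ, Γ.IsGeodesic γ x y := by
  obtain ⟨p, hp⟩ := Γ.connected.exists_walk_length_eq_dist x y
  have hp : p.length = Γ.dist x y := hp
  have hright : p.getVert (Γ.dist x y) = y := hp ▸ p.getVert_length
  have hedge : ∀ t < Γ.dist x y, Γ.Edge (p.getVert t) (p.getVert (t + 1)) := fun t ht =>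
    (adj_iff.1 (p.adj_getVert_succ (hp ▸ ht))).2
  refine ⟨p.getVert, hedge, fun t ht => ?_, hright⟩
  have hleft := dist_le_sub_of_edge t.zero_le fun i _ hit => hedge i (hit.trans_le ht)
  have hrest := dist_le_sub_of_edge ht fun i _ hi => hedge i hi
  rw [p.getVert_zero] at hleft
  rw [hright] at hrest
  have := dist_triangle (Γ := Γ) x (p.getVert t) y
  omega

theorem mem_of_edge_closed {S : Set V} (hx : x ∈ S)
    (hS : ∀ y ∈ S, ∀ z, Γ.Edge y z → z ∈ S) (z : V) : z ∈ S := by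
  obtain ⟨γ, hγ⟩ := Γ.exists_isGeodesic x z
  have hmem : ∀ t ≤ Γ.dist x z, γ t ∈ S := fun t => by
    induction t with
    | zero => exact fun _ => hγ.left ▸ hx
    | succ t ih => exact fun ht => hS _ (ih (Nat.le_of_lt ht)) _ (hγ.edge t ht)
  exact hγ.right ▸ hmem _ le_rfl

theorem mem_ball {R : ℝ} : y ∈ Γ.ball x R ↔ (Γ.dist x y : ℝ) < R := Iff.rfl

theorem mem_ball_self {R : ℝ} (hR : 0 < R) : x ∈ Γ.ball x R := by
  simpa [mem_ball] using hR

theorem ball_mono (x : V) {r R : ℝ} (h : r ≤ R) : Γ.ball x r ⊆ Γ.ball x R :=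
  fun _ hy => lt_of_lt_of_le hy h

theorem ball_subset_ball {r R : ℝ} (h : Γ.dist x y + r ≤ R) : Γ.ball y r ⊆ Γ.ball x R := by
  intro z hz
  have htri : (Γ.dist x z : ℝ) ≤ Γ.dist x y + Γ.dist y z := by
    exact_mod_cast dist_triangle x y z
  have hyz : (Γ.dist y z : ℝ) < r := hz
  exact mem_ball.2 (by linarith)

/-- Every vertex has finitely many neighbours. -/
def LocallyFinite (Γ : WeightedGraph V) : Prop := ∀ x, (Function.support (Γ.w x)).Finite

theorem CondP0.locallyFinite [Nontrivial V] (h : Γ.CondP0) : Γ.LocallyFinite := by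
  obtain ⟨p, hp, hP⟩ := h
  intro x
  have hsmall : ∀ᶠ y in Filter.cofinite, Γ.w x y < p * Γ.mu x :=
    (Γ.summable x).tendsto_cofinite_zero.eventually (gt_mem_nhds (mul_pos hp (Γ.mu_pos x)))
  refine (Filter.eventually_cofinite.1 hsmall).subset fun y hy => not_lt.2 ?_
  have hxy : Γ.Edge x y := lt_of_le_of_ne (Γ.nonneg x y) (Ne.symm hy)
  exact (le_div_iff₀ (Γ.mu_pos x)).1 (hP x y hxy)

theorem LocallyFinite.finite_closedBall (h : Γ.LocallyFinite) (x : V) (n : ℕ) :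
    {y | Γ.dist x y ≤ n}.Finite := by
  induction n with
  | zero => exact (Set.finite_singleton x).subset fun y hy =>
      (dist_eq_zero.1 (Nat.le_zero.1 hy)).symm
  | succ n ih =>
    refine (ih.union (ih.biUnion fun z _ => h z)).subset fun y hy => ?_
    rcases Nat.le_or_eq_of_le_succ hy with hn | hn
    · exact Or.inl hn
    · obtain ⟨γ, hγ⟩ := Γ.exists_isGeodesic x y
      have hlast : γ (n + 1) = y := by rw [← hγ.right, hn]
      have hedge : Γ.Edge (γ n) y := hlast ▸ hγ.edge n (by omega)
      exact Or.inr (Set.mem_biUnion (hγ.dist_left n (by omega)).le hedge.ne')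

theorem LocallyFinite.finite_ball (h : Γ.LocallyFinite) (x : V) (R : ℝ) :
    (Γ.ball x R).Finite :=
  (h.finite_closedBall x ⌈R⌉₊).subset fun _ hy =>
    Nat.cast_le.1 ((le_of_lt hy).trans (Nat.le_ceil R))

theorem LocallyFinite.exists_dist_eq [Infinite V] (h : Γ.LocallyFinite) (x : V) (n : ℕ) :
    ∃ y, Γ.dist x y = n := by
  obtain ⟨y, hy⟩ := (h.finite_closedBall x n).exists_notMem
  obtain ⟨γ, hγ⟩ := Γ.exists_isGeodesic x y
  exact ⟨γ n, hγ.dist_left n (not_le.1 hy).le⟩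

end Distance

section Markov

variable {V : Type*} {Γ : WeightedGraph V} {D : Set V} {u : V → ℝ} {x y : V}

theorem mu_nonneg (x : V) : 0 ≤ Γ.mu x := tsum_nonneg (Γ.nonneg x)

theorem P_nonneg (x y : V) : 0 ≤ Γ.P x y := div_nonneg (Γ.nonneg x y) (mu_nonneg x)

theorem Edge.P_pos [Nontrivial V] (h : Γ.Edge x y) : 0 < Γ.P x y := div_pos h (Γ.mu_pos x)

theorem P_eq_zero (h : ¬ Γ.Edge x y) : Γ.P x y = 0 := by
  rw [P, w_eq_zero_of_not_edge h, zero_div]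

theorem tsum_P [Nontrivial V] (x : V) : ∑' y, Γ.P x y = 1 :=
  tsum_div_const.trans (div_self (Γ.mu_pos x).ne')

theorem summable_P_mul (hx : (Function.support (Γ.w x)).Finite) (f : V → ℝ) :
    Summable fun y => Γ.P x y * f y :=
  summable_of_hasFiniteSupport <| hx.subset fun y hy hw => hy <| by
    simp only [P, hw, zero_div, zero_mul]

/-- The functional `f ↦ P f (x)` at a vertex `x` with finitely many neighbours, where it is defined
and linear on all functions. -/
noncomputable def markovAt (hx : (Function.support (Γ.w x)).Finite) : (V → ℝ) →ₗ[ℝ] ℝ where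
  toFun f := Γ.markov f x
  map_add' f g := by
    simp only [markov, Pi.add_apply, mul_add]
    exact (summable_P_mul hx f).tsum_add (summable_P_mul hx g)
  map_smul' c f := by
    simp only [markov, Pi.smul_apply, smul_eq_mul, mul_left_comm _ c, tsum_mul_left,
      RingHom.id_apply]

theorem markov_sub (hx : (Function.support (Γ.w x)).Finite) (f g : V → ℝ) :
    Γ.markov (f - g) x = Γ.markov f x - Γ.markov g x := map_sub (markovAt hx) f g

theorem markov_const [Nontrivial V] (c : ℝ) (x : V) : Γ.markov (fun _ => c) x = c := by
  rw [markov, tsum_mul_right, tsum_P, one_mul]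

theorem markov_nonneg {f : V → ℝ} (hf : ∀ y, 0 ≤ f y) (x : V) : 0 ≤ Γ.markov f x :=
  tsum_nonneg fun y => mul_nonneg (P_nonneg x y) (hf y)

theorem eq_of_edge_of_le_markov_of_forall_le [Nontrivial V]
    (hx : (Function.support (Γ.w x)).Finite) (hsub : u x ≤ Γ.markov u x)
    (hmax : ∀ y, Γ.Edge x y → u y ≤ u x) (hxy : Γ.Edge x y) : u y = u x := by
  let v : V → ℝ := (fun _ => u x) - u
  have hterm : ∀ z, 0 ≤ Γ.P x z * v z := fun z => by
    by_cases hz : Γ.Edge x z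
    · exact mul_nonneg (P_nonneg x z) (sub_nonneg.2 (hmax z hz))
    · rw [P_eq_zero hz, zero_mul]
  have hmean : Γ.markov v x = u x - Γ.markov u x := by
    rw [markov_sub hx, markov_const]
  have hle : Γ.P x y * v y ≤ 0 :=
    ((summable_P_mul hx v).le_tsum y fun z _ => hterm z).trans (hmean.trans_le (by linarith))
  have hvy : v y ≤ 0 := nonpos_of_mul_nonpos_right hle hxy.P_pos
  exact (hmax y hxy).antisymm (sub_nonpos.1 hvy)

/-- The sets on which the Dirichlet problem is a finite linear system: finite proper subsets of the
vertex set whose points have finitely many neighbours. -/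
structure DirichletDomain (Γ : WeightedGraph V) (D : Set V) : Prop where
  finite : D.Finite
  exists_notMem : ∃ z, z ∉ D
  finite_support : ∀ x ∈ D, (Function.support (Γ.w x)).Finite

theorem DirichletDomain.mono (hD : Γ.DirichletDomain D) {D' : Set V} (h : D' ⊆ D) :
    Γ.DirichletDomain D' where
  finite := hD.finite.subset h
  exists_notMem := hD.exists_notMem.imp fun _ hz => mt (@h _) hz
  finite_support x hx := hD.finite_support x (h hx)

theorem LocallyFinite.dirichletDomain_ball [Infinite V] (h : Γ.LocallyFinite) (x : V) (R : ℝ) :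
    Γ.DirichletDomain (Γ.ball x R) where
  finite := h.finite_ball x R
  exists_notMem := (h.finite_ball x R).exists_notMem
  finite_support y _ := h y

theorem DirichletDomain.le_of_le_markov [Nontrivial V] (hD : Γ.DirichletDomain D) {c : ℝ}
    (hsub : ∀ y ∈ D, u y ≤ Γ.markov u y)
    (hbd : ∀ y ∈ D, ∀ z ∉ D, Γ.Edge y z → u z ≤ c) : ∀ y ∈ D, u y ≤ c := by
  intro y hy
  by_contra! hc
  obtain ⟨a, haD, hmax⟩ := Set.exists_max_image D u hD.finite ⟨y, hy⟩
  have hca : c < u a := hc.trans_le (hmax y hy)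
  have hclosed : ∀ z ∈ {z ∈ D | u z = u a}, ∀ z', Γ.Edge z z' → z' ∈ {z ∈ D | u z = u a} := by
    rintro z ⟨hz, hza⟩ z' hzz'
    have hnbr : ∀ b, Γ.Edge z b → u b ≤ u z := fun b hb => by
      by_cases hbD : b ∈ D
      · exact hza ▸ hmax b hbD
      · exact hza ▸ (hbd z hz b hbD hb).trans hca.le
    have heq : u z' = u a :=
      (eq_of_edge_of_le_markov_of_forall_le (hD.finite_support z hz) (hsub z hz) hnbr hzz').trans
        hza
    refine ⟨?_, heq⟩
    by_contra hz'
    exact absurd (hbd z hz z' hz' hzz') (heq ▸ not_le.2 hca)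
  obtain ⟨z, hz⟩ := hD.exists_notMem
  exact hz (mem_of_edge_closed (S := {z ∈ D | u z = u a}) ⟨haD, rfl⟩ hclosed z).1

theorem DirichletDomain.le_of_markov_le [Nontrivial V] (hD : Γ.DirichletDomain D) {c : ℝ}
    (hsup : ∀ y ∈ D, Γ.markov u y ≤ u y)
    (hbd : ∀ y ∈ D, ∀ z ∉ D, Γ.Edge y z → c ≤ u z) : ∀ y ∈ D, c ≤ u y := by
  intro y hy
  have hneg : ∀ z ∈ D, (-u) z ≤ Γ.markov (-u) z := fun z hz =>
    (neg_le_neg (hsup z hz)).trans_eq (map_neg (markovAt (hD.finite_support z hz)) u).symm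
  exact neg_le_neg_iff.1 <|
    hD.le_of_le_markov hneg (fun z hz z' hz' h => neg_le_neg (hbd z hz z' hz' h)) y hy

end Markov

section Green

variable {V : Type*} [Nontrivial V] {Γ : WeightedGraph V} {D : Set V} {y z : V}

theorem DirichletDomain.exists_poisson (hD : Γ.DirichletDomain D) (φ : V → ℝ) :
    ∃ f : V → ℝ, (∀ z ∉ D, f z = 0) ∧ ∀ z ∈ D, f z = Γ.markov f z + φ z := by
  have := hD.finite.to_subtype
  let ext : (D → ℝ) →ₗ[ℝ] (V → ℝ) := Function.ExtendByZero.linearMap ℝ Subtype.val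
  have hout : ∀ f, ∀ z ∉ D, ext f z = 0 := fun f z hz =>
    Function.extend_apply' (f := Subtype.val) f 0 z fun ⟨a, ha⟩ => hz (ha ▸ a.2)
  have hin : ∀ f (z : D), ext f z = f z := fun f z =>
    Subtype.val_injective.extend_apply f 0 z
  let T : (D → ℝ) →ₗ[ℝ] (D → ℝ) :=
    LinearMap.id - LinearMap.pi fun z : D => markovAt (hD.finite_support z z.2) ∘ₗ ext
  have hT : ∀ f, ∀ z (hz : z ∈ D), ext f z = Γ.markov (ext f) z + T f ⟨z, hz⟩ := fun f z hz =>
    (hin f ⟨z, hz⟩).trans (add_sub_cancel _ _).symm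
  have hinj : Function.Injective T := (injective_iff_map_eq_zero T).2 fun f hf => by
    have hharm : ∀ z ∈ D, ext f z = Γ.markov (ext f) z := fun z hz => by
      simpa only [hf, Pi.zero_apply, add_zero] using hT f z hz
    funext z
    rw [← hin f z]
    exact le_antisymm
      (hD.le_of_le_markov (fun z hz => (hharm z hz).le) (fun _ _ z hz _ => (hout f z hz).le) z z.2)
      (hD.le_of_markov_le (fun z hz => (hharm z hz).ge) (fun _ _ z hz _ => (hout f z hz).ge) z z.2)
  obtain ⟨f, hf⟩ := LinearMap.injective_iff_surjective.1 hinj fun z => φ z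
  exact ⟨ext f, hout f, fun z hz => by rw [hT f z hz, hf]⟩

/-- `f` is the Green function with pole `y` of the walk killed on leaving `D`, normalized by `μ`. -/
structure IsGreen (Γ : WeightedGraph V) (D : Set V) (y : V) (f : V → ℝ) : Prop where
  eq_zero : ∀ z ∉ D, f z = 0
  markov_eq : ∀ z ∈ D, z ≠ y → Γ.markov f z = f z
  pole : y ∈ D → f y = Γ.markov f y + (Γ.mu y)⁻¹

/-- The Green function `g^D(y, ·)` of the walk killed on leaving `D`, normalized by `μ`. It is an
arbitrary function when there is no such Green function, but there is one on a Dirichlet domain. -/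
noncomputable def green (Γ : WeightedGraph V) (D : Set V) (y : V) : V → ℝ :=
  Classical.epsilon (Γ.IsGreen D y)

theorem DirichletDomain.isGreen_green (hD : Γ.DirichletDomain D) (y : V) :
    Γ.IsGreen D y (Γ.green D y) := by
  classical
  obtain ⟨f, hout, hin⟩ := hD.exists_poisson fun z => if z = y then (Γ.mu y)⁻¹ else 0
  exact Classical.epsilon_spec (p := Γ.IsGreen D y)
    ⟨f, hout, fun z hz hzy => by simp [hin z hz, hzy], fun hy => by simpa using hin y hy⟩

theorem DirichletDomain.green_eq_zero (hD : Γ.DirichletDomain D) (y : V) (hz : z ∉ D) :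
    Γ.green D y z = 0 := (hD.isGreen_green y).eq_zero z hz

theorem DirichletDomain.markov_green (hD : Γ.DirichletDomain D) (hz : z ∈ D) (hzy : z ≠ y) :
    Γ.markov (Γ.green D y) z = Γ.green D y z := (hD.isGreen_green y).markov_eq z hz hzy

theorem DirichletDomain.green_self (hD : Γ.DirichletDomain D) (hy : y ∈ D) :
    Γ.green D y y = Γ.markov (Γ.green D y) y + (Γ.mu y)⁻¹ := (hD.isGreen_green y).pole hy

theorem DirichletDomain.markov_green_le (hD : Γ.DirichletDomain D) (y : V) (hz : z ∈ D) :
    Γ.markov (Γ.green D y) z ≤ Γ.green D y z := by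
  rcases eq_or_ne z y with rfl | hzy
  · exact (le_add_of_nonneg_right (inv_nonneg.2 (mu_nonneg z))).trans_eq (hD.green_self hz).symm
  · exact (hD.markov_green hz hzy).le

theorem DirichletDomain.green_nonneg (hD : Γ.DirichletDomain D) (y z : V) :
    0 ≤ Γ.green D y z := by
  by_cases hz : z ∈ D
  · exact hD.le_of_markov_le (fun _ => hD.markov_green_le y)
      (fun _ _ b hb _ => (hD.green_eq_zero y hb).ge) z hz
  · exact (hD.green_eq_zero y hz).ge

theorem DirichletDomain.green_self_pos (hD : Γ.DirichletDomain D) (hy : y ∈ D) :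
    0 < Γ.green D y y := by
  rw [hD.green_self hy]
  exact add_pos_of_nonneg_of_pos (markov_nonneg (hD.green_nonneg y) y) (inv_pos.2 (Γ.mu_pos y))

theorem DirichletDomain.green_eq_zero_left (hD : Γ.DirichletDomain D) (hy : y ∉ D) (z : V) :
    Γ.green D y z = 0 := by
  by_cases hz : z ∈ D
  · have hharm : ∀ a ∈ D, Γ.markov (Γ.green D y) a = Γ.green D y a := fun a ha =>
      hD.markov_green ha (ne_of_mem_of_not_mem ha hy)
    exact (hD.le_of_le_markov (fun a ha => (hharm a ha).ge)
      (fun _ _ b hb _ => (hD.green_eq_zero y hb).le) z hz).antisymm (hD.green_nonneg y z)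
  · exact hD.green_eq_zero y hz

theorem DirichletDomain.green_le_green_add (hD : Γ.DirichletDomain D) {D' : Set V} (hD' : D' ⊆ D)
    {b : ℝ} (hb : ∀ z ∉ D', Γ.green D y z ≤ b) (z : V) :
    Γ.green D y z ≤ Γ.green D' y z + b := by
  have hDir := hD.mono hD'
  by_cases hz : z ∈ D'
  · have hharm : ∀ a ∈ D', (Γ.green D y - Γ.green D' y) a ≤
        Γ.markov (Γ.green D y - Γ.green D' y) a := fun a ha => by
      rw [markov_sub (hDir.finite_support a ha), Pi.sub_apply]
      rcases eq_or_ne a y with rfl | hay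
      · rw [hD.green_self (hD' ha), hDir.green_self ha, add_sub_add_right_eq_sub]
      · rw [hD.markov_green (hD' ha) hay, hDir.markov_green ha hay]
    have hbd : ∀ a ∈ D', ∀ c ∉ D', Γ.Edge a c → (Γ.green D y - Γ.green D' y) c ≤ b :=
      fun a _ c hc _ => by rw [Pi.sub_apply, hDir.green_eq_zero y hc, sub_zero]; exact hb c hc
    exact sub_le_iff_le_add'.1 (hDir.le_of_le_markov hharm hbd z hz)
  · rw [hDir.green_eq_zero y hz, zero_add]
    exact hb z hz

end Green

section Energy

variable {V : Type*} {Γ : WeightedGraph V} {D : Set V} {f g : V → ℝ} {x y : V}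

/-- The Dirichlet form `(-Δ f, g)_μ`. -/
noncomputable def energy (Γ : WeightedGraph V) (f g : V → ℝ) : ℝ :=
  Γ.innerMu (fun x => - Γ.laplace f x) g

theorem energy_smul_smul (Γ : WeightedGraph V) (c : ℝ) (f : V → ℝ) :
    Γ.energy (c • f) (c • f) = c ^ 2 * Γ.energy f f := by
  have hmarkov : ∀ x, Γ.markov (c • f) x = c * Γ.markov f x := fun x => by
    simp only [markov, Pi.smul_apply, smul_eq_mul, mul_left_comm _ c, tsum_mul_left]
  rw [energy, energy, innerMu, innerMu, ← tsum_mul_left]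
  refine tsum_congr fun x => ?_
  simp only [laplace, hmarkov, Pi.smul_apply, smul_eq_mul]
  ring

theorem DirichletDomain.exists_finset_neighborhood (hD : Γ.DirichletDomain D) :
    ∃ S : Finset V, D ⊆ S ∧ ∀ x ∈ D, ∀ y ∉ S, Γ.w x y = 0 := by
  have hfin := hD.finite.union (hD.finite.biUnion hD.finite_support)
  refine ⟨hfin.toFinset, fun x hx => ?_, fun x hx y hy => ?_⟩
  · exact hfin.mem_toFinset.2 (Or.inl hx)
  · by_contra hw
    exact hy (hfin.mem_toFinset.2 (Or.inr (Set.mem_biUnion hx hw)))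

variable [Nontrivial V]

theorem neg_laplace_mul_mu {S : Finset V} (hS : ∀ y ∉ S, Γ.w x y = 0) (f : V → ℝ) :
    - Γ.laplace f x * Γ.mu x = ∑ y ∈ S, Γ.w x y * (f x - f y) := by
  have hmu : Γ.mu x = ∑ y ∈ S, Γ.w x y := tsum_eq_sum hS
  have hmarkov : Γ.mu x * Γ.markov f x = ∑ y ∈ S, Γ.w x y * f y := by
    rw [markov, tsum_eq_sum fun y hy => by rw [P, hS y hy, zero_div, zero_mul], Finset.mul_sum]
    exact Finset.sum_congr rfl fun y _ => by rw [P, ← mul_assoc, mul_div_cancel₀ _ (Γ.mu_pos x).ne']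
  simp only [mul_sub, Finset.sum_sub_distrib, ← Finset.sum_mul, ← hmu, ← hmarkov, laplace]
  ring

theorem energy_eq_sum_sub_mul {S : Finset V} (hDS : D ⊆ S)
    (hS : ∀ x ∈ D, ∀ y ∉ S, Γ.w x y = 0) (f : V → ℝ) (hg : ∀ x ∉ D, g x = 0) :
    Γ.energy f g = ∑ x ∈ S, ∑ y ∈ S, Γ.w x y * (f x - f y) * g x := by
  rw [energy, innerMu, tsum_eq_sum fun x hx => by rw [hg x fun h => hx (hDS h)]; ring]
  refine Finset.sum_congr rfl fun x _ => ?_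
  by_cases hx : x ∈ D
  · rw [mul_right_comm, neg_laplace_mul_mu (hS x hx), Finset.sum_mul]
  · simp only [hg x hx, mul_zero, zero_mul, Finset.sum_const_zero]

theorem DirichletDomain.exists_energy_eq_sum (hD : Γ.DirichletDomain D) :
    ∃ S : Finset V, ∀ f g : V → ℝ, (∀ x ∉ D, g x = 0) →
      Γ.energy f g = (∑ x ∈ S, ∑ y ∈ S, Γ.w x y * ((f x - f y) * (g x - g y))) / 2 := by
  obtain ⟨S, hDS, hS⟩ := hD.exists_finset_neighborhood
  refine ⟨S, fun f g hg => ?_⟩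
  have hleft := energy_eq_sum_sub_mul hDS hS f hg
  have hright : Γ.energy f g = ∑ x ∈ S, ∑ y ∈ S, Γ.w x y * (f y - f x) * g y := by
    rw [hleft, Finset.sum_comm]
    exact Finset.sum_congr rfl fun x _ => Finset.sum_congr rfl fun y _ => by rw [Γ.symm y x]
  rw [eq_div_iff two_ne_zero, mul_two]
  nth_rw 1 [hleft]
  simp only [hright, ← Finset.sum_add_distrib]
  exact Finset.sum_congr rfl fun x _ => Finset.sum_congr rfl fun y _ => by ring

theorem DirichletDomain.energy_comm (hD : Γ.DirichletDomain D) (hf : ∀ x ∉ D, f x = 0)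
    (hg : ∀ x ∉ D, g x = 0) : Γ.energy f g = Γ.energy g f := by
  obtain ⟨S, hS⟩ := hD.exists_energy_eq_sum
  simp only [hS f g hg, hS g f hf, mul_comm (f _ - f _)]

theorem DirichletDomain.energy_congr_left (hD : Γ.DirichletDomain D) {f' : V → ℝ}
    (hg : ∀ x ∉ D, g x = 0)
    (h : ∀ x y, Γ.Edge x y → (f x - f y) * (g x - g y) = (f' x - f' y) * (g x - g y)) :
    Γ.energy f g = Γ.energy f' g := by
  obtain ⟨S, hS⟩ := hD.exists_energy_eq_sum
  rw [hS f g hg, hS f' g hg]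
  congr 1
  refine Finset.sum_congr rfl fun x _ => Finset.sum_congr rfl fun y _ => ?_
  by_cases hxy : Γ.Edge x y
  · rw [h x y hxy]
  · simp only [w_eq_zero_of_not_edge hxy, zero_mul]

theorem DirichletDomain.two_mul_energy_le (hD : Γ.DirichletDomain D) (hf : ∀ x ∉ D, f x = 0)
    (hg : ∀ x ∉ D, g x = 0) {b : ℝ} (hb : 0 < b) :
    2 * Γ.energy f g ≤ b⁻¹ * Γ.energy f f + b * Γ.energy g g := by
  have hamgm : ∀ s t : ℝ, 2 * (s * t) ≤ b⁻¹ * (s * s) + b * (t * t) := fun s t => by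
    have hsq : 0 ≤ b⁻¹ * (s - b * t) ^ 2 := by positivity
    have hexpand : b⁻¹ * (s - b * t) ^ 2 = b⁻¹ * (s * s) + b * (t * t) - 2 * (s * t) := by
      field_simp
      ring
    linarith
  obtain ⟨S, hS⟩ := hD.exists_energy_eq_sum
  rw [hS f g hg, hS f f hf, hS g g hg, ← mul_div_assoc, ← mul_div_assoc, ← mul_div_assoc,
    ← add_div]
  refine div_le_div_of_nonneg_right ?_ zero_le_two
  simp only [Finset.mul_sum, ← Finset.sum_add_distrib]
  refine Finset.sum_le_sum fun x _ => Finset.sum_le_sum fun y _ => ?_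
  linarith [mul_le_mul_of_nonneg_left (hamgm (f x - f y) (g x - g y)) (Γ.nonneg x y)]

theorem min_sub_min_mul_self_le (s t a : ℝ) :
    (min s a - min t a) * (min s a - min t a) ≤ (s - t) * (min s a - min t a) := by
  rcases le_total s a with hs | hs <;> rcases le_total t a with ht | ht <;>
    simp only [min_eq_left, min_eq_right, hs, ht] <;> nlinarith

theorem DirichletDomain.energy_min_le (hD : Γ.DirichletDomain D) {a : ℝ}
    (hf : ∀ x ∉ D, min (f x) a = 0) :
    Γ.energy (fun x => min (f x) a) (fun x => min (f x) a) ≤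
      Γ.energy f (fun x => min (f x) a) := by
  obtain ⟨S, hS⟩ := hD.exists_energy_eq_sum
  rw [hS _ _ hf, hS _ _ hf]
  refine div_le_div_of_nonneg_right ?_ zero_le_two
  exact Finset.sum_le_sum fun x _ => Finset.sum_le_sum fun y _ =>
    mul_le_mul_of_nonneg_left (min_sub_min_mul_self_le _ _ _) (Γ.nonneg x y)

theorem DirichletDomain.energy_green (hD : Γ.DirichletDomain D) (hy : y ∈ D)
    (hf : ∀ x ∉ D, f x = 0) : Γ.energy (Γ.green D y) f = f y := by
  rw [energy, innerMu, tsum_eq_single y]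
  · rw [laplace, hD.green_self hy, sub_add_cancel_left, neg_neg, mul_right_comm,
      inv_mul_cancel₀ (Γ.mu_pos y).ne', one_mul]
  · intro z hz
    by_cases hzD : z ∈ D
    · rw [laplace, hD.markov_green hzD hz, sub_self, neg_zero, zero_mul, zero_mul]
    · rw [hf z hzD, mul_zero, zero_mul]

theorem DirichletDomain.green_comm (hD : Γ.DirichletDomain D) (y z : V) :
    Γ.green D y z = Γ.green D z y := by
  by_cases hy : y ∈ D
  · by_cases hz : z ∈ D
    · have hout : ∀ a, ∀ x ∉ D, Γ.green D a x = 0 := fun a _ hx => hD.green_eq_zero a hx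
      rw [← hD.energy_green hz (hout y), hD.energy_comm (hout z) (hout y),
        hD.energy_green hy (hout z)]
    · rw [hD.green_eq_zero y hz, hD.green_eq_zero_left hz]
  · rw [hD.green_eq_zero_left hy, hD.green_eq_zero z hy]

theorem DirichletDomain.min_green_eq_zero (hD : Γ.DirichletDomain D) {a : ℝ} (ha : 0 ≤ a)
    (y : V) : ∀ x ∉ D, min (Γ.green D y x) a = 0 := fun _ hx => by
  rw [hD.green_eq_zero y hx, min_eq_left ha]

theorem DirichletDomain.energy_min_green_le (hD : Γ.DirichletDomain D) (hy : y ∈ D) {a : ℝ}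
    (ha : 0 ≤ a) :
    Γ.energy (fun x => min (Γ.green D y x) a) (fun x => min (Γ.green D y x) a) ≤ a :=
  calc
    _ ≤ Γ.energy (Γ.green D y) (fun x => min (Γ.green D y x) a) :=
      hD.energy_min_le (hD.min_green_eq_zero ha y)
    _ = min (Γ.green D y y) a := hD.energy_green hy (hD.min_green_eq_zero ha y)
    _ ≤ a := min_le_right _ _

end Energy

section Resistance

variable {V : Type*} [Nontrivial V] {Γ : WeightedGraph V} {D A : Set V} {x : V}

theorem DirichletDomain.ofReal_le_resistance (hD : Γ.DirichletDomain D) (hx : x ∈ D) {a : ℝ}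
    (ha : ∀ z ∈ A, a ≤ Γ.green D x z) : ENNReal.ofReal a ≤ Γ.resistance A Dᶜ := by
  rcases le_or_gt a 0 with ha₀ | ha₀
  · exact (ENNReal.ofReal_of_nonpos ha₀).trans_le zero_le
  let m : V → ℝ := fun z => min (Γ.green D x z) a
  have hout : ∀ z ∉ D, (a⁻¹ • m) z = 0 := fun z hz => by
    simp only [m, Pi.smul_apply, hD.min_green_eq_zero ha₀.le x z hz, smul_zero]
  let F : V →₀ ℝ := Finsupp.onFinset hD.finite.toFinset (a⁻¹ • m)
    fun z hz => hD.finite.mem_toFinset.2 (not_imp_comm.1 (hout z) hz)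
  have hFA : ∀ z ∈ A, F z = 1 := fun z hz =>
    (congrArg (a⁻¹ * ·) (min_eq_right (ha z hz))).trans (inv_mul_cancel₀ ha₀.ne')
  have henergy : Γ.energy F F ≤ a⁻¹ := calc
    Γ.energy F F = a⁻¹ ^ 2 * Γ.energy m m := Γ.energy_smul_smul a⁻¹ m
    _ ≤ a⁻¹ ^ 2 * a := by gcongr; exact hD.energy_min_green_le hx ha₀.le
    _ = a⁻¹ := by field_simp
  rw [resistance, ENNReal.le_inv_iff_le_inv, ← ENNReal.ofReal_inv_of_pos ha₀]
  exact iInf_le_of_le F <| iInf_le_of_le hFA <| iInf_le_of_le (fun z hz => hout z hz) <|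
    ENNReal.ofReal_le_ofReal henergy

theorem DirichletDomain.resistance_le_ofReal (hD : Γ.DirichletDomain D) (hx : x ∈ D)
    (hxA : x ∈ A) {b : ℝ} (hb : 0 < b)
    (hgb : ∀ y z, Γ.Edge y z → z ∉ A → Γ.green D x y ≤ b ∧ Γ.green D x z ≤ b) :
    Γ.resistance A Dᶜ ≤ ENNReal.ofReal b := by
  rw [resistance, ENNReal.inv_le_iff_inv_le, ← ENNReal.ofReal_inv_of_pos hb]
  refine le_iInf fun f => le_iInf fun hfA => le_iInf fun hfD => ENNReal.ofReal_le_ofReal ?_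
  change b⁻¹ ≤ Γ.energy f f
  let m : V → ℝ := fun z => min (Γ.green D x z) b
  have hm : ∀ z ∉ D, m z = 0 := hD.min_green_eq_zero hb.le x
  -- On an edge either `f` is constant or the truncation at height `b` changes neither value.
  have hedge : ∀ y z, Γ.Edge y z →
      (Γ.green D x y - Γ.green D x z) * (f y - f z) = (m y - m z) * (f y - f z) := by
    intro y z hyz
    by_cases hA : y ∈ A ∧ z ∈ A
    · rw [hfA y hA.1, hfA z hA.2, sub_self, mul_zero, mul_zero]
    · obtain ⟨hy, hz⟩ : Γ.green D x y ≤ b ∧ Γ.green D x z ≤ b := by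
        rcases not_and_or.1 hA with hy | hz
        · exact (hgb z y hyz.symm hy).symm
        · exact hgb y z hyz hz
      simp only [m, min_eq_left hy, min_eq_left hz]
  have hone : Γ.energy m f = 1 := by
    rw [← hD.energy_congr_left hfD hedge, hD.energy_green hx hfD, hfA x hxA]
  have hmm : b⁻¹ * Γ.energy m m ≤ 1 :=
    (inv_mul_le_iff₀ hb).2 ((hD.energy_min_green_le hx hb.le).trans_eq (mul_one b).symm)
  rw [inv_le_iff_one_le_mul₀' hb]
  linarith [hD.two_mul_energy_le hm hfD hb]

end Resistance

section Harnack

variable {V : Type*} {Γ : WeightedGraph V} {D : Set V} {u : V → ℝ} {γ : ℕ → V} {x y z : V} {H : ℝ}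

/-- The elliptic Harnack inequality with constant `H`. -/
def HarnackWith (Γ : WeightedGraph V) (H : ℝ) : Prop :=
  ∀ (x : V) (R : ℝ), 0 < R → ∀ u : V → ℝ, (∀ y, 0 ≤ u y) →
    Γ.HarmonicOn u (Γ.ball x (2 * R)) →
    ∀ y ∈ Γ.ball x R, ∀ z ∈ Γ.ball x R, u y ≤ H * u z

theorem HarnackWith.le_pow_mul_of_chain (hH : Γ.HarnackWith H) (hH₀ : 0 < H) (hu : ∀ y, 0 ≤ u y)
    {r : ℝ} (hr : 0 < r) {n : ℕ} (hγ : ∀ i < n, γ (i + 1) ∈ Γ.ball (γ i) r)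
    (hharm : ∀ i < n, Γ.HarmonicOn u (Γ.ball (γ i) (2 * r))) :
    u (γ 0) ≤ H ^ n * u (γ n) ∧ u (γ n) ≤ H ^ n * u (γ 0) := by
  have hstep : ∀ i < n, u (γ i) ≤ H * u (γ (i + 1)) ∧ u (γ (i + 1)) ≤ H * u (γ i) := fun i hi =>
    ⟨hH _ r hr u hu (hharm i hi) _ (mem_ball_self hr) _ (hγ i hi),
      hH _ r hr u hu (hharm i hi) _ (hγ i hi) _ (mem_ball_self hr)⟩
  have hforward : H⁻¹ ^ n * u (γ 0) ≤ u (γ n) :=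
    geom_le (u := u ∘ γ) (inv_nonneg.2 hH₀.le) n fun i hi => (inv_mul_le_iff₀ hH₀).2 (hstep i hi).1
  rw [inv_pow, inv_mul_le_iff₀ (pow_pos hH₀ n)] at hforward
  exact ⟨hforward, le_geom (u := u ∘ γ) hH₀.le n fun i hi => (hstep i hi).2⟩

theorem HarnackWith.le_pow_mul_of_isGeodesic (hH : Γ.HarnackWith H) (hH₀ : 0 < H)
    (hu : ∀ y, 0 ≤ u y) (hγ : Γ.IsGeodesic γ x y) {j N a b : ℕ} (hj : 0 < j) (hab : a ≤ b)
    (hb : b ≤ Γ.dist x y) (hN : b ≤ a + N * j)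
    (hharm : ∀ t, a ≤ t → t ≤ b → Γ.HarmonicOn u (Γ.ball (γ t) (4 * j))) :
    u (γ a) ≤ H ^ N * u (γ b) ∧ u (γ b) ≤ H ^ N * u (γ a) := by
  let τ : ℕ → ℕ := fun i => min (a + i * j) b
  have hj₀ : (0 : ℝ) < j := Nat.cast_pos.2 hj
  have hτ₀ : τ 0 = a := by simp only [τ, zero_mul, add_zero, min_eq_left hab]
  have hτN : τ N = b := min_eq_right hN
  have hchain : ∀ i < N, γ (τ (i + 1)) ∈ Γ.ball (γ (τ i)) (2 * j) := fun i _ => by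
    have hmono : τ i ≤ τ (i + 1) := min_le_min_right b (by gcongr; omega)
    have hstep : τ (i + 1) ≤ τ i + j := by simp only [τ, add_mul, one_mul]; omega
    have hdist : Γ.dist (γ (τ i)) (γ (τ (i + 1))) ≤ j :=
      (hγ.dist_le_sub hmono ((min_le_right _ _).trans hb)).trans (by omega)
    have hdist' : (Γ.dist (γ (τ i)) (γ (τ (i + 1))) : ℝ) ≤ j := Nat.cast_le.2 hdist
    exact mem_ball.2 (by linarith)
  have hball : ∀ i < N, Γ.HarmonicOn u (Γ.ball (γ (τ i)) (2 * (2 * j))) := fun i _ => by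
    rw [show (2 : ℝ) * (2 * j) = 4 * j by ring]
    exact hharm _ (le_min le_self_add hab) (min_le_right _ _)
  simpa only [Function.comp_apply, hτ₀, hτN] using
    hH.le_pow_mul_of_chain (γ := γ ∘ τ) hH₀ hu (mul_pos two_pos hj₀) hchain hball

theorem DirichletDomain.pow_dist_mul_le (hD : Γ.DirichletDomain D) {p : ℝ} (hp : 0 < p)
    (hP : ∀ x y, Γ.Edge x y → p ≤ Γ.P x y) (hu : ∀ y, 0 ≤ u y)
    (hsup : ∀ y ∈ D, Γ.markov u y ≤ u y) (hγ : Γ.IsGeodesic γ x z)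
    (hγD : ∀ t ≤ Γ.dist x z, γ t ∈ D) :
    p ^ Γ.dist x z * u x ≤ u z ∧ p ^ Γ.dist x z * u z ≤ u x := by
  have hstep : ∀ a ∈ D, ∀ b, Γ.Edge a b → p * u b ≤ u a := fun a ha b hab =>
    calc p * u b ≤ Γ.P a b * u b := mul_le_mul_of_nonneg_right (hP a b hab) (hu b)
      _ ≤ Γ.markov u a := (summable_P_mul (hD.finite_support a ha) u).le_tsum b fun c _ =>
        mul_nonneg (P_nonneg a c) (hu c)
      _ ≤ u a := hsup a ha
  have hforward : p ^ Γ.dist x z * u (γ 0) ≤ u (γ (Γ.dist x z)) :=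
    geom_le (u := u ∘ γ) hp.le _ fun t ht => hstep _ (hγD _ ht) _ (hγ.edge t ht).symm
  have hbackward : u (γ (Γ.dist x z)) ≤ p⁻¹ ^ Γ.dist x z * u (γ 0) :=
    le_geom (u := u ∘ γ) (inv_nonneg.2 hp.le) _ fun t ht =>
      (le_inv_mul_iff₀ hp).2 (hstep _ (hγD t ht.le) _ (hγ.edge t ht))
  rw [inv_pow, le_inv_mul_iff₀ (pow_pos hp _)] at hbackward
  rw [hγ.left, hγ.right] at hforward hbackward
  exact ⟨hforward, hbackward⟩

variable [Nontrivial V]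

theorem DirichletDomain.harmonicOn_green (hD : Γ.DirichletDomain D) {A : Set V} (hA : A ⊆ D)
    (hy : y ∉ A) : Γ.HarmonicOn (Γ.green D y) A :=
  fun _ hz => hD.markov_green (hA hz) (ne_of_mem_of_not_mem hz hy)

theorem HarnackWith.green_le_pow_mul_of_isGeodesic (hH : Γ.HarnackWith H) (hH₀ : 0 < H)
    (hD : Γ.DirichletDomain D) (hγ : Γ.IsGeodesic γ x y) {j N a b : ℕ} (hj : 0 < j) (hab : a ≤ b)
    (hb : b ≤ Γ.dist x y) (hN : b ≤ a + N * j) (hsub : Γ.ball x ((b + 4 * j : ℕ) : ℝ) ⊆ D)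
    (hz : ∀ t, a ≤ t → t ≤ b → 4 * j ≤ Γ.dist (γ t) z) :
    Γ.green D z (γ a) ≤ H ^ N * Γ.green D z (γ b) ∧
      Γ.green D z (γ b) ≤ H ^ N * Γ.green D z (γ a) := by
  refine hH.le_pow_mul_of_isGeodesic hH₀ (hD.green_nonneg z) hγ hj hab hb hN fun t hat htb =>
    hD.harmonicOn_green ((ball_subset_ball ?_).trans hsub) ?_
  · have : (t : ℝ) ≤ b := Nat.cast_le.2 htb
    rw [hγ.dist_left t (htb.trans hb)]
    push_cast
    linarith
  · rw [mem_ball, not_lt]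
    exact_mod_cast hz t hat htb

theorem HarnackWith.green_le_of_dist_eq_of_near (hH : Γ.HarnackWith H) (hH₀ : 0 < H)
    (hD : Γ.DirichletDomain D) (hγ : Γ.IsGeodesic γ x y) {j t : ℕ} (hj : 0 < j)
    (hsub : Γ.ball x ((16 * j : ℕ) : ℝ) ⊆ D) (hy : Γ.dist x y = 12 * j)
    (hz : Γ.dist x z = 8 * j) (ht : t ≤ 12 * j) (hzt : Γ.dist z (γ t) < 4 * j) :
    Γ.green D x y ≤ H ^ 9 * Γ.green D x z := by
  have : (0 : ℝ) < j := Nat.cast_pos.2 hj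
  have hγy : γ (12 * j) = y := hy ▸ hγ.right
  have hxt : Γ.dist x (γ t) = t := hγ.dist_left t (ht.trans_eq hy.symm)
  have htri := dist_triangle (Γ := Γ) x (γ t) z
  rw [dist_comm (γ t)] at htri
  have hyt : Γ.green D x y ≤ H ^ 8 * Γ.green D x (γ t) := hγy ▸
    (hH.green_le_pow_mul_of_isGeodesic hH₀ hD hγ hj ht hy.ge (by omega)
      ((ball_mono x (Nat.cast_le.2 (by omega))).trans hsub)
      fun i hti hi => by rw [dist_comm, hγ.dist_left i (by omega)]; omega).2
  have htz : Γ.green D x (γ t) ≤ H * Γ.green D x z := by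
    refine hH z (4 * j) (by positivity) _ (hD.green_nonneg x) (hD.harmonicOn_green
      ((ball_subset_ball ?_).trans hsub) ?_) _ ?_ _ (mem_ball_self (by positivity))
    · rw [hz]; push_cast; linarith
    · rw [mem_ball, not_lt, dist_comm, hz]; push_cast; linarith
    · rw [mem_ball]; exact_mod_cast hzt
  calc Γ.green D x y ≤ H ^ 8 * (H * Γ.green D x z) := hyt.trans (by gcongr)
    _ = H ^ 9 * Γ.green D x z := by ring

/-- The pole is moved from `x` to `y` and then to `z`, by symmetry of the Green function. -/
theorem HarnackWith.green_le_of_dist_eq_of_far (hH : Γ.HarnackWith H) (hH₀ : 0 < H)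
    (hD : Γ.DirichletDomain D) (hγ : Γ.IsGeodesic γ x y) {j : ℕ} (hj : 0 < j)
    (hsub : Γ.ball x ((16 * j : ℕ) : ℝ) ⊆ D) (hy : Γ.dist x y = 12 * j)
    (hz : Γ.dist x z = 8 * j) (hfar : ∀ t ≤ 12 * j, 4 * j ≤ Γ.dist z (γ t)) :
    Γ.green D x y ≤ H ^ 20 * Γ.green D x z := by
  have hsub' : ∀ {n : ℕ}, n ≤ 16 * j → Γ.ball x (n : ℝ) ⊆ D := fun hn =>
    (ball_mono x (Nat.cast_le.2 hn)).trans hsub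
  have hγy : γ (12 * j) = y := hy ▸ hγ.right
  obtain ⟨η, hη⟩ := Γ.exists_isGeodesic x z
  have hηz : η (8 * j) = z := hz ▸ hη.right
  have hpole_y : Γ.green D y x ≤ H ^ 8 * Γ.green D y z := by
    have h := (hH.green_le_pow_mul_of_isGeodesic (z := y) (N := 8) hH₀ hD hη hj (Nat.zero_le _)
      hz.ge (by omega) (hsub' (by omega)) fun t _ ht => by
        have htri := dist_triangle (Γ := Γ) x (η t) y
        rw [hη.dist_left t (by omega)] at htri
        omega).1
    rwa [hη.left, hηz] at h
  have hpole_z : Γ.green D z y ≤ H ^ 12 * Γ.green D z x := by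
    have h := (hH.green_le_pow_mul_of_isGeodesic (z := z) (N := 12) hH₀ hD hγ hj (Nat.zero_le _)
      hy.ge (by omega) (hsub' (by omega)) fun t _ ht => by
        rw [dist_comm]; exact hfar t ht).2
    rwa [hγ.left, hγy] at h
  calc Γ.green D x y = Γ.green D y x := hD.green_comm x y
    _ ≤ H ^ 8 * Γ.green D z y := hD.green_comm z y ▸ hpole_y
    _ ≤ H ^ 8 * (H ^ 12 * Γ.green D x z) := by
      gcongr; exact hD.green_comm x z ▸ hpole_z
    _ = H ^ 20 * Γ.green D x z := by ring

theorem HarnackWith.green_le_of_dist_eq (hH : Γ.HarnackWith H) (hH₁ : 1 ≤ H)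
    (hD : Γ.DirichletDomain D) {j : ℕ} (hj : 0 < j)
    (hsub : Γ.ball x ((16 * j : ℕ) : ℝ) ⊆ D) (hy : Γ.dist x y = 12 * j)
    (hz : Γ.dist x z = 8 * j) : Γ.green D x y ≤ H ^ 20 * Γ.green D x z := by
  have hH₀ : 0 < H := one_pos.trans_le hH₁
  obtain ⟨γ, hγ⟩ := Γ.exists_isGeodesic x y
  by_cases hnear : ∃ t ≤ 12 * j, Γ.dist z (γ t) < 4 * j
  · obtain ⟨t, ht, hzt⟩ := hnear
    exact (hH.green_le_of_dist_eq_of_near hH₀ hD hγ hj hsub hy hz ht hzt).trans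
      (mul_le_mul_of_nonneg_right (pow_le_pow_right₀ hH₁ (by norm_num)) (hD.green_nonneg x z))
  · push Not at hnear
    exact hH.green_le_of_dist_eq_of_far hH₀ hD hγ hj hsub hy hz hnear

theorem HarnackWith.green_le_of_le_dist (hH : Γ.HarnackWith H) (hH₁ : 1 ≤ H)
    (hD : Γ.DirichletDomain D) {j N : ℕ} (hj : 0 < j) (hy : Γ.dist x y = 12 * j)
    (hz : 8 * j ≤ Γ.dist x z) (hzN : Γ.dist x z ≤ N * j) (hsub : Γ.ball x ((16 * j : ℕ) : ℝ) ⊆ D)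
    (hsubz : Γ.ball x ((Γ.dist x z + 4 * j : ℕ) : ℝ) ⊆ D) :
    Γ.green D x y ≤ H ^ (20 + N) * Γ.green D x z := by
  have hH₀ : 0 < H := one_pos.trans_le hH₁
  obtain ⟨γ, hγ⟩ := Γ.exists_isGeodesic x z
  have hyp : Γ.green D x y ≤ H ^ 20 * Γ.green D x (γ (8 * j)) :=
    hH.green_le_of_dist_eq hH₁ hD hj hsub hy (hγ.dist_left _ hz)
  have hpz : Γ.green D x (γ (8 * j)) ≤ H ^ N * Γ.green D x z := by
    have h := (hH.green_le_pow_mul_of_isGeodesic (z := x) (N := N) hH₀ hD hγ hj hz le_rfl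
      (by omega) hsubz fun t ht ht' => by rw [dist_comm, hγ.dist_left t ht']; omega).1
    rwa [hγ.right] at h
  calc Γ.green D x y ≤ H ^ 20 * (H ^ N * Γ.green D x z) := hyp.trans (by gcongr)
    _ = H ^ (20 + N) * Γ.green D x z := by ring

theorem DirichletDomain.green_le_of_sphere (hD : Γ.DirichletDomain D) {n : ℕ} {c : ℝ} (hc : 0 ≤ c)
    (h : ∀ y, Γ.dist x y = n → Γ.green D x y ≤ c) (hy : n ≤ Γ.dist x y) :
    Γ.green D x y ≤ c := by
  by_cases hyD : y ∈ D
  · rcases hy.eq_or_lt with hy | hy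
    · exact h y hy.symm
    have hdom : Γ.DirichletDomain {z ∈ D | n < Γ.dist x z} := hD.mono (Set.sep_subset _ _)
    refine hdom.le_of_le_markov (u := Γ.green D x) (fun a ha => ?_) (fun a ha b hb hab => ?_)
      y ⟨hyD, hy⟩
    · exact (hD.markov_green ha.1 fun hax => by simp [hax] at ha).ge
    · by_cases hbD : b ∈ D
      · have hbn : Γ.dist x b ≤ n := not_lt.1 fun hlt => hb ⟨hbD, hlt⟩
        have hstep := hab.symm.dist_le_succ x
        have := ha.2
        exact h b (by omega)
      · exact (hD.green_eq_zero x hbD).trans_le hc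
  · exact (hD.green_eq_zero x hyD).trans_le hc

theorem DirichletDomain.le_green_of_sphere (hD : Γ.DirichletDomain D) {R a : ℝ}
    (hsub : Γ.ball x R ⊆ D)
    (h : ∀ z, R ≤ Γ.dist x z → (Γ.dist x z : ℝ) ≤ R + 1 → a ≤ Γ.green D x z) :
    ∀ z ∈ Γ.ball x R, a ≤ Γ.green D x z := by
  refine (hD.mono hsub).le_of_markov_le (fun y hy => hD.markov_green_le x (hsub hy))
    fun y hy z hz hyz => h z (not_lt.1 hz) ?_
  have hstep : (Γ.dist x z : ℝ) ≤ Γ.dist x y + 1 := by exact_mod_cast hyz.dist_le_succ x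
  have := mem_ball.1 hy
  linarith

theorem HarnackWith.green_le_of_large (hH : Γ.HarnackWith H) (hH₁ : 1 ≤ H)
    (hD : Γ.DirichletDomain D) {R : ℝ} {j N : ℕ} (hj : 0 < j) (hjR : 8 * (j : ℝ) ≤ R)
    (hR : 1 + 4 * (j : ℝ) ≤ R) (hRN : R + 1 ≤ N * j) (hsub : Γ.ball x (2 * R) ⊆ D)
    (hy : 12 * j ≤ Γ.dist x y) (hz : z ∈ Γ.ball x R) :
    Γ.green D x y ≤ H ^ (20 + N) * Γ.green D x z := by
  have hC : 0 < H ^ (20 + N) := pow_pos (one_pos.trans_le hH₁) _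
  have hball : ∀ n : ℕ, (n : ℝ) ≤ 2 * R → Γ.ball x n ⊆ D := fun n hn =>
    (ball_mono x hn).trans hsub
  have hspheres : ∀ a, Γ.dist x a = 12 * j → ∀ b, R ≤ Γ.dist x b → (Γ.dist x b : ℝ) ≤ R + 1 →
      Γ.green D x a ≤ H ^ (20 + N) * Γ.green D x b := fun a ha b hb hb' =>
    hH.green_le_of_le_dist hH₁ hD hj ha
      (by exact_mod_cast hjR.trans hb) (by exact_mod_cast hb'.trans hRN)
      (hball _ (by push_cast; linarith)) (hball _ (by push_cast; linarith))
  refine (inv_mul_le_iff₀ hC).1 (hD.le_green_of_sphere ((ball_mono x (by linarith)).trans hsub)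
    (fun b hb hb' => (inv_mul_le_iff₀ hC).2 ?_) z hz)
  exact hD.green_le_of_sphere (mul_nonneg hC.le (hD.green_nonneg x b))
    (fun a ha => hspheres a ha b hb hb') hy

end Harnack

section CondP0

variable {V : Type*} [Infinite V] {Γ : WeightedGraph V}

theorem CondP0.exists_pow_dist_mul_green_le (hp₀ : Γ.CondP0) :
    ∃ p : ℝ, 0 < p ∧ p ≤ 1 ∧ ∀ (x : V) (R : ℝ), ∀ z ∈ Γ.ball x R,
      p ^ Γ.dist x z * Γ.green (Γ.ball x R) x x ≤ Γ.green (Γ.ball x R) x z ∧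
        p ^ Γ.dist x z * Γ.green (Γ.ball x R) x z ≤ Γ.green (Γ.ball x R) x x := by
  have hlf := hp₀.locallyFinite
  obtain ⟨p, hp, hP⟩ := hp₀
  refine ⟨min p 1, lt_min hp one_pos, min_le_right _ _, fun x R z hz => ?_⟩
  have hD := hlf.dirichletDomain_ball x R
  obtain ⟨γ, hγ⟩ := Γ.exists_isGeodesic x z
  refine hD.pow_dist_mul_le (lt_min hp one_pos)
    (fun a b hab => (min_le_left _ _).trans (hP a b hab)) (hD.green_nonneg x)
    (fun y => hD.markov_green_le x) hγ fun t ht => ?_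
  rw [mem_ball, hγ.dist_left t ht]
  exact (Nat.cast_le.2 ht).trans_lt hz

theorem CondP0.green_pos (hp₀ : Γ.CondP0) {x z : V} {R : ℝ} (hz : z ∈ Γ.ball x R) :
    0 < Γ.green (Γ.ball x R) x z := by
  have hR : 0 < R := (Nat.cast_nonneg _).trans_lt hz
  obtain ⟨p, hp, -, hle⟩ := hp₀.exists_pow_dist_mul_green_le
  have hpole := (hp₀.locallyFinite.dirichletDomain_ball x R).green_self_pos (mem_ball_self hR)
  exact (mul_pos (pow_pos hp _) hpole).trans_le (hle x R z hz).1

theorem CondP0.exists_green_le_of_bounded (hp₀ : Γ.CondP0) (K : ℕ) :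
    ∃ C : ℝ, 0 < C ∧ ∀ (x : V) (R : ℝ), R ≤ K → ∀ y, ∀ z ∈ Γ.ball x R,
      Γ.green (Γ.ball x R) x y ≤ C * Γ.green (Γ.ball x R) x z := by
  obtain ⟨p, hp, hp₁, hle⟩ := hp₀.exists_pow_dist_mul_green_le
  have hpK : 0 < p ^ K := pow_pos hp K
  refine ⟨(p ^ K)⁻¹ * (p ^ K)⁻¹, by positivity, fun x R hR y z hz => ?_⟩
  have hD := hp₀.locallyFinite.dirichletDomain_ball x R
  have hnn := hD.green_nonneg x
  by_cases hy : y ∈ Γ.ball x R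
  · have hpow : ∀ a ∈ Γ.ball x R, p ^ K ≤ p ^ Γ.dist x a := fun a ha =>
      pow_le_pow_of_le_one hp.le hp₁ (Nat.cast_le.1 ((le_of_lt ha).trans hR))
    have hyx : p ^ K * Γ.green (Γ.ball x R) x y ≤ Γ.green (Γ.ball x R) x x :=
      (mul_le_mul_of_nonneg_right (hpow y hy) (hnn y)).trans (hle x R y hy).2
    have hxz : p ^ K * Γ.green (Γ.ball x R) x x ≤ Γ.green (Γ.ball x R) x z :=
      (mul_le_mul_of_nonneg_right (hpow z hz) (hnn x)).trans (hle x R z hz).1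
    rw [mul_assoc, le_inv_mul_iff₀ hpK, le_inv_mul_iff₀ hpK]
    exact (mul_le_mul_of_nonneg_left hyx hpK.le).trans hxz
  · rw [hD.green_eq_zero x hy]
    exact mul_nonneg (by positivity) (hnn z)

/-- Scales with `ε R ≤ 40` are covered by `(p₀)`, the larger ones by a chain of balls of radius
comparable with `ε R`. -/
theorem CondP0.exists_green_le_of_ellipticHarnack (hp₀ : Γ.CondP0) (hH : Γ.EllipticHarnack)
    {ε : ℝ} (hε : 0 < ε) (hε₁ : ε ≤ 1) :
    ∃ C : ℝ, 0 < C ∧ ∀ (x : V) (R : ℝ), 1 / 2 < R → ∀ y, ε * R ≤ Γ.dist x y + 1 →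
      ∀ z ∈ Γ.ball x R,
        Γ.green (Γ.ball x (2 * R)) x y ≤ C * Γ.green (Γ.ball x (2 * R)) x z := by
  obtain ⟨H, hH₁, hH⟩ : ∃ H : ℝ, 1 < H ∧ Γ.HarnackWith H := hH
  obtain ⟨K, hK⟩ := exists_nat_gt (80 / ε)
  obtain ⟨N, hN⟩ := exists_nat_gt (40 / ε)
  obtain ⟨C, hC, hsmall⟩ := hp₀.exists_green_le_of_bounded K
  refine ⟨max C (H ^ (20 + N)), lt_max_of_lt_left hC, fun x R hR y hy z hz => ?_⟩
  have hD := hp₀.locallyFinite.dirichletDomain_ball x (2 * R)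
  have hnn := hD.green_nonneg x z
  rcases le_or_gt (2 * R) K with hRK | hRK
  · exact (hsmall x (2 * R) hRK y z (ball_mono x (by linarith) hz)).trans
      (mul_le_mul_of_nonneg_right (le_max_left _ _) hnn)
  refine le_trans ?_ (mul_le_mul_of_nonneg_right (le_max_right _ _) hnn)
  have hεR : 40 < ε * R := by
    have := (div_lt_iff₀ hε).1 (hK.trans hRK)
    linarith
  have hεR₁ : ε * R ≤ R := mul_le_of_le_one_left (by linarith) hε₁
  let j : ℕ := ⌊(ε * R - 1) / 12⌋₊
  have hj_le : (j : ℝ) ≤ (ε * R - 1) / 12 := Nat.floor_le (by linarith)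
  have hj_ge : ε * R / 20 ≤ j := by linarith [Nat.lt_floor_add_one ((ε * R - 1) / 12)]
  have hj : 0 < j := Nat.cast_pos.1 (show (0 : ℝ) < j by linarith)
  have hRN : R + 1 ≤ N * j := calc
    R + 1 ≤ (40 / ε) * (ε * R / 20) := by field_simp; linarith
    _ ≤ N * j := by gcongr
  have hyj : ((12 * j : ℕ) : ℝ) ≤ Γ.dist x y := by push_cast; linarith
  exact hH.green_le_of_large hH₁.le hD hj (by linarith) (by linarith) hRN subset_rfl
    (Nat.cast_le.1 hyj) hz

end CondP0

section Walk

variable {V : Type*}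

/-- The event that a path stays in `D` up to time `n`, that is, the event `n < T_D`. -/
def stays (D : Set V) (n : ℕ) : Set (ℕ → V) := {X | ∀ k ≤ n, X k ∈ D}

theorem mem_stays {D : Set V} {n : ℕ} {X : ℕ → V} : X ∈ stays D n ↔ ∀ k ≤ n, X k ∈ D := Iff.rfl

theorem exitTime_eq_tsum (D : Set V) (X : ℕ → V) :
    exitTime D X = ∑' n, (stays D n).indicator 1 X := by
  classical
  by_cases h : ∃ k, X k ∉ D
  · have hstays : ∀ n, X ∈ stays D n ↔ n < Nat.find h := fun n => by
      simp only [mem_stays, Nat.lt_find_iff, not_not]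
    calc exitTime D X = Nat.find h :=
          le_antisymm (iInf₂_le (Nat.find h) (Nat.find_spec h))
            (le_iInf₂ fun k hk => Nat.cast_le.2 (Nat.find_min' h hk))
      _ = ∑ n ∈ Finset.range (Nat.find h), (stays D n).indicator 1 X := by
          rw [Finset.sum_congr rfl fun n hn =>
            Set.indicator_of_mem ((hstays n).2 (Finset.mem_range.1 hn)) _]
          simp
      _ = ∑' n, (stays D n).indicator 1 X := (tsum_eq_sum fun n hn =>
          Set.indicator_of_notMem (fun hX => hn (Finset.mem_range.2 ((hstays n).1 hX))) _).symm
  · push Not at h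
    have hstays : ∀ n, (stays D n).indicator (1 : (ℕ → V) → ℝ≥0∞) X = 1 := fun n =>
      Set.indicator_of_mem (mem_stays.2 fun k _ => h k) _
    simp only [hstays, exitTime, h, not_true_eq_false, iInf_false, iInf_const]
    exact (ENNReal.tsum_const_eq_top_of_ne_zero one_ne_zero).symm

variable [MeasurableSpace V] [DiscreteMeasurableSpace V]

theorem measurableSet_stays (D : Set V) (n : ℕ) : MeasurableSet (stays D n) := by
  rw [show stays D n = ⋂ k ≤ n, (· k) ⁻¹' D by ext X; simp [mem_stays]]
  exact .iInter fun k => .iInter fun _ => measurable_pi_apply k (.of_discrete)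

variable [Countable V] [Nontrivial V] {Γ : WeightedGraph V} {D : Set V} {e : V → ℝ≥0∞} {n : ℕ}

theorem lintegral_stepPMF (y : V) (f : V → ℝ≥0∞) :
    ∫⁻ z, f z ∂(Γ.stepPMF y).toMeasure = ∑' z, ENNReal.ofReal (Γ.P y z) * f z := by
  rw [lintegral_countable']
  refine tsum_congr fun z => ?_
  rw [PMF.toMeasure_apply_singleton _ _ (measurableSet_singleton z), mul_comm]
  rfl

instance isProbabilityMeasure_walkLaw (x : V) : IsProbabilityMeasure (Γ.walkLaw x) :=
  inferInstanceAs (IsProbabilityMeasure (Kernel.trajMeasure (X := fun _ => V) _ _))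

theorem lintegral_walkLaw_zero (x : V) (f : V → ℝ≥0∞) : ∫⁻ X, f (X 0) ∂(Γ.walkLaw x) = f x := by
  have hf : Measurable f := measurable_of_countable f
  have hmap : ∫⁻ X, f (X 0) ∂(Γ.walkLaw x) =
      ∫⁻ p, f (p ⟨0, Finset.mem_Iic.2 le_rfl⟩) ∂((Γ.walkLaw x).map
        (Preorder.frestrictLe (π := fun _ : ℕ => V) 0)) := by
    rw [lintegral_map (by fun_prop) (Preorder.measurable_frestrictLe 0)]
    rfl
  rw [hmap, walkLaw, Kernel.trajMeasure, Measure.map_comp _ _ (by fun_prop),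
    Kernel.traj_map_frestrictLe, Kernel.partialTraj_self, Measure.id_comp,
    lintegral_map (by fun_prop) (by fun_prop), lintegral_dirac' _ (by fun_prop)]
  rfl

theorem setLIntegral_walkLaw_succ (x : V) {S : Set (Finset.Iic n → V)} (hS : MeasurableSet S)
    (f : V → ℝ≥0∞) :
    ∫⁻ X in Preorder.frestrictLe n ⁻¹' S, f (X (n + 1)) ∂(Γ.walkLaw x) =
      ∫⁻ X in Preorder.frestrictLe n ⁻¹' S, ∑' z, ENNReal.ofReal (Γ.P (X n) z) * f z
        ∂(Γ.walkLaw x) := by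
  have hf : Measurable f := measurable_of_countable f
  have hlaw := Kernel.map_frestrictLe_trajMeasure_compProd_eq_map_trajMeasure
    (X := fun _ => V) (μ₀ := Measure.dirac x) (κ := Γ.stepKernel) (a := n)
  calc ∫⁻ X in Preorder.frestrictLe n ⁻¹' S, f (X (n + 1)) ∂(Γ.walkLaw x)
      = ∫⁻ p in S ×ˢ Set.univ, f p.2 ∂((Γ.walkLaw x).map
          fun X => (Preorder.frestrictLe (π := fun _ : ℕ => V) n X, X (n + 1))) := by
        rw [setLIntegral_map (hS.prod .univ) (by fun_prop) (by fun_prop)]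
        simp only [Set.mk_preimage_prod, Set.preimage_univ, Set.inter_univ]
    _ = ∫⁻ h in S, ∫⁻ z, f z ∂(Γ.stepKernel n h)
          ∂((Γ.walkLaw x).map (Preorder.frestrictLe (π := fun _ : ℕ => V) n)) := by
        rw [walkLaw, ← hlaw, Measure.setLIntegral_compProd (by fun_prop) hS .univ]
        simp only [Measure.restrict_univ]
    _ = ∫⁻ X in Preorder.frestrictLe n ⁻¹' S, ∑' z, ENNReal.ofReal (Γ.P (X n) z) * f z
          ∂(Γ.walkLaw x) := by
        rw [setLIntegral_map hS (by fun_prop) (Preorder.measurable_frestrictLe n)]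
        exact lintegral_congr fun X => lintegral_stepPMF _ _

theorem meanExit_eq_tsum_walkLaw_stays (x : V) (D : Set V) :
    Γ.meanExit x D = ∑' n, Γ.walkLaw x (stays D n) := by
  simp only [meanExit, exitTime_eq_tsum]
  rw [lintegral_tsum fun n => (measurable_one.indicator (measurableSet_stays D n)).aemeasurable]
  exact tsum_congr fun n => lintegral_indicator_one (measurableSet_stays D n)

theorem setLIntegral_stays_zero (he : ∀ y ∉ D, e y = 0) (x : V) :
    ∫⁻ X in stays D 0, e (X 0) ∂(Γ.walkLaw x) = e x := by
  rw [← lintegral_indicator (measurableSet_stays D 0), ← lintegral_walkLaw_zero (Γ := Γ) x e]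
  refine lintegral_congr fun X => Set.indicator_apply_eq_self.2 fun hX => he _ fun h0 => hX ?_
  exact fun k hk => Nat.le_zero.1 hk ▸ h0

theorem setLIntegral_stays_succ (he : ∀ y ∉ D, e y = 0)
    (hsol : ∀ y ∈ D, e y = 1 + ∑' z, ENNReal.ofReal (Γ.P y z) * e z) (x : V) (n : ℕ) :
    ∫⁻ X in stays D n, e (X n) ∂(Γ.walkLaw x) =
      Γ.walkLaw x (stays D n) + ∫⁻ X in stays D (n + 1), e (X (n + 1)) ∂(Γ.walkLaw x) := by
  have hstays : stays D n = Preorder.frestrictLe n ⁻¹' {h : Finset.Iic n → V | ∀ k, h k ∈ D} := by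
    ext X
    simp [mem_stays]
  have hmeas : MeasurableSet {h : Finset.Iic n → V | ∀ k, h k ∈ D} := by
    rw [Set.ofPred_forall]
    exact .iInter fun k => measurable_pi_apply k (.of_discrete)
  have hmarkov : ∫⁻ X in stays D n, e (X (n + 1)) ∂(Γ.walkLaw x) =
      ∫⁻ X in stays D n, ∑' z, ENNReal.ofReal (Γ.P (X n) z) * e z ∂(Γ.walkLaw x) :=
    hstays ▸ setLIntegral_walkLaw_succ x hmeas e
  have hvanish : ∫⁻ X in stays D (n + 1), e (X (n + 1)) ∂(Γ.walkLaw x) =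
      ∫⁻ X in stays D n, e (X (n + 1)) ∂(Γ.walkLaw x) := by
    rw [← lintegral_indicator (measurableSet_stays D _),
      ← lintegral_indicator (measurableSet_stays D n)]
    refine lintegral_congr fun X => ?_
    by_cases hX : X (n + 1) ∈ D
    · have hiff : X ∈ stays D (n + 1) ↔ X ∈ stays D n := by
        simp only [mem_stays, Nat.le_succ_iff, or_imp, forall_and, forall_eq, hX, and_true]
      exact Set.indicator_eq_indicator hiff rfl
    · simp only [Set.indicator, he _ hX, ite_self]
  rw [hvanish, hmarkov, ← setLIntegral_one, ← lintegral_add_left measurable_const]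
  exact setLIntegral_congr_fun (measurableSet_stays D n) fun X hX => hsol _ (hX n le_rfl)

theorem meanExit_eq_of_poisson (he : ∀ y ∉ D, e y = 0) {M : ℝ≥0∞} (hM : M ≠ ⊤)
    (heM : ∀ y, e y ≤ M) (hsol : ∀ y ∈ D, e y = 1 + ∑' z, ENNReal.ofReal (Γ.P y z) * e z) (x : V) :
    Γ.meanExit x D = e x := by
  rw [meanExit_eq_tsum_walkLaw_stays]
  have htelescope : ∀ N, e x = ∑ n ∈ Finset.range N, Γ.walkLaw x (stays D n) +
      ∫⁻ X in stays D N, e (X N) ∂(Γ.walkLaw x) := fun N => by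
    induction N with
    | zero => rw [Finset.sum_range_zero, zero_add, setLIntegral_stays_zero he]
    | succ N ih => rw [ih, setLIntegral_stays_succ he hsol, Finset.sum_range_succ, add_assoc]
  have hle : ∑' n, Γ.walkLaw x (stays D n) ≤ e x :=
    ENNReal.tsum_le_of_sum_range_le fun N => (htelescope N).symm ▸ le_self_add
  refine hle.antisymm ?_
  have htail : Filter.Tendsto (fun N => M * Γ.walkLaw x (stays D N)) .atTop (nhds 0) := by
    simpa only [mul_zero] using ENNReal.Tendsto.const_mul (ENNReal.tendsto_atTop_zero_of_tsum_ne_top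
      (ne_top_of_le_ne_top hM (hle.trans (heM x)))) (.inr hM)
  have hlim := (ENNReal.tendsto_nat_tsum fun n => Γ.walkLaw x (stays D n)).add htail
  rw [add_zero] at hlim
  refine ge_of_tendsto' hlim fun N => (htelescope N).trans_le ?_
  gcongr
  calc ∫⁻ X in stays D N, e (X N) ∂(Γ.walkLaw x) ≤ ∫⁻ _ in stays D N, M ∂(Γ.walkLaw x) :=
        lintegral_mono fun X => heM (X N)
    _ = M * Γ.walkLaw x (stays D N) := setLIntegral_const _ _

end Walk

section MeanExit

variable {V : Type*} {Γ : WeightedGraph V} {D : Set V} {x y z : V}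

theorem ofReal_markov (hx : (Function.support (Γ.w x)).Finite) {f : V → ℝ} (hf : ∀ y, 0 ≤ f y) :
    ENNReal.ofReal (Γ.markov f x) = ∑' y, ENNReal.ofReal (Γ.P x y) * ENNReal.ofReal (f y) := by
  rw [markov, ENNReal.ofReal_tsum_of_nonneg (fun y => mul_nonneg (P_nonneg x y) (hf y))
    (summable_P_mul hx f)]
  exact tsum_congr fun y => ENNReal.ofReal_mul (P_nonneg x y)

variable [Nontrivial V]

theorem DirichletDomain.ofReal_green_mul_mu (hD : Γ.DirichletDomain D) (hz : z ∈ D)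
    [Decidable (y = z)] :
    ENNReal.ofReal (Γ.green D y z) * ENNReal.ofReal (Γ.mu y) =
      (if y = z then 1 else 0) +
        ENNReal.ofReal (Γ.markov (Γ.green D y) z) * ENNReal.ofReal (Γ.mu y) := by
  split_ifs with hyz
  · subst hyz
    have hmarkov := markov_nonneg (Γ := Γ) (hD.green_nonneg y) y
    rw [hD.green_self hz, add_comm, ENNReal.ofReal_add (inv_nonneg.2 (mu_nonneg y)) hmarkov,
      add_mul, ← ENNReal.ofReal_mul (inv_nonneg.2 (mu_nonneg y)),
      inv_mul_cancel₀ (Γ.mu_pos y).ne', ENNReal.ofReal_one]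
  · rw [zero_add, hD.markov_green hz (Ne.symm hyz)]

theorem DirichletDomain.tsum_green_mul_mu (hD : Γ.DirichletDomain D) (hz : z ∈ D) :
    ∑' y, ENNReal.ofReal (Γ.green D y z) * ENNReal.ofReal (Γ.mu y) =
      1 + ∑' a, ENNReal.ofReal (Γ.P z a) *
        ∑' y, ENNReal.ofReal (Γ.green D y a) * ENNReal.ofReal (Γ.mu y) := by
  classical
  simp only [hD.ofReal_green_mul_mu hz, ENNReal.tsum_add, tsum_ite_eq,
    ofReal_markov (hD.finite_support z hz) (hD.green_nonneg _), ← ENNReal.tsum_mul_left,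
    ← ENNReal.tsum_mul_right, mul_assoc]
  rw [ENNReal.tsum_comm]

theorem DirichletDomain.meanExit_eq_tsum [Countable V] [MeasurableSpace V]
    [DiscreteMeasurableSpace V] (hD : Γ.DirichletDomain D) (x : V) :
    Γ.meanExit x D = ∑' y, ENNReal.ofReal (Γ.green D x y) * ENNReal.ofReal (Γ.mu y) := by
  let e : V → ℝ≥0∞ := fun z => ∑' y, ENNReal.ofReal (Γ.green D y z) * ENNReal.ofReal (Γ.mu y)
  have he : ∀ z ∉ D, e z = 0 := fun z hz => by
    simp only [e, hD.green_eq_zero _ hz, ENNReal.ofReal_zero, zero_mul, tsum_zero]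
  have hfinite : ∀ z, e z ≠ ⊤ := fun z => by
    have hsum : e z = ∑ y ∈ hD.finite.toFinset, _ := tsum_eq_sum fun y hy => by
      rw [hD.green_eq_zero_left (fun h => hy (hD.finite.mem_toFinset.2 h)), ENNReal.ofReal_zero,
        zero_mul]
    rw [hsum]
    exact ENNReal.sum_ne_top.2 fun _ _ => ENNReal.mul_ne_top ENNReal.ofReal_ne_top
      ENNReal.ofReal_ne_top
  have hbound : ∀ z, e z ≤ ∑ y ∈ hD.finite.toFinset, e y := fun z => by
    by_cases hz : z ∈ D
    · exact Finset.single_le_sum (fun _ _ => zero_le) (hD.finite.mem_toFinset.2 hz)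
    · exact (he z hz).trans_le zero_le
  rw [meanExit_eq_of_poisson he (ENNReal.sum_ne_top.2 fun y _ => hfinite y) hbound
    fun z hz => hD.tsum_green_mul_mu hz]
  simp only [e, hD.green_comm x]

end MeanExit

section Volume

variable {V : Type*} {Γ : WeightedGraph V} {x : V} {r R : ℝ} {B : Set V}

theorem vol_mono {A : Set V} (hAB : A ⊆ B) : Γ.vol A ≤ Γ.vol B :=
  ENNReal.tsum_mono_subtype (fun y => ENNReal.ofReal (Γ.mu y)) hAB

theorem vol_ne_top (hB : B.Finite) : Γ.vol B ≠ ⊤ := by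
  have := hB.fintype
  rw [vol, tsum_fintype]
  exact ENNReal.sum_ne_top.2 fun _ _ => ENNReal.ofReal_ne_top

theorem vol_le_annulusVol (hfin : Γ.ballVol x r ≠ ⊤) (hrR : r ≤ R)
    (hB : B ⊆ Γ.ball x R \ Γ.ball x r) : Γ.vol B ≤ Γ.annulusVol x r R := by
  have hdisj : Disjoint (Γ.ball x r) B := Set.disjoint_left.2 fun y hy hyB => (hB hyB).2 hy
  refine ENNReal.le_sub_of_add_le_left hfin ?_
  calc Γ.ballVol x r + Γ.vol B = Γ.vol (Γ.ball x r ∪ B) :=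
        (ENNReal.summable.tsum_union_disjoint (f := fun y => ENNReal.ofReal (Γ.mu y)) hdisj
          ENNReal.summable).symm
    _ ≤ Γ.ballVol x R := vol_mono (Set.union_subset (ball_mono x hrR) fun y hy => (hB hy).1)

theorem ballVol_two_pow_mul_le {c : ℝ≥0∞}
    (hc : ∀ r, 0 < r → Γ.ballVol x (2 * r) ≤ c * Γ.ballVol x r) (hR : 0 < R) (n : ℕ) :
    Γ.ballVol x (2 ^ n * R) ≤ c ^ n * Γ.ballVol x R := by
  induction n with
  | zero => simp
  | succ n ih =>
    calc Γ.ballVol x (2 ^ (n + 1) * R) = Γ.ballVol x (2 * (2 ^ n * R)) := by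
          rw [pow_succ', mul_assoc]
      _ ≤ c * (c ^ n * Γ.ballVol x R) := (hc _ (by positivity)).trans (by gcongr)
      _ = c ^ (n + 1) * Γ.ballVol x R := by rw [pow_succ', mul_assoc]

theorem LocallyFinite.exists_ball_subset_annulus [Infinite V] (h : Γ.LocallyFinite) (x : V)
    (hR : 1 / 2 < R) :
    ∃ y, Γ.dist x y ≤ 2 * R ∧ Γ.ball y (R / 4) ⊆ Γ.ball x (2 * R) \ Γ.ball x R := by
  let k : ℕ := ⌈R / 4⌉₊ - 1
  have hk : ⌈R / 4⌉₊ = k + 1 := (Nat.sub_add_cancel (Nat.one_le_ceil_iff.2 (by linarith))).symm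
  have hkR : (k : ℝ) < R / 4 := Nat.lt_ceil.1 (by omega)
  have hfit : (⌈R⌉₊ : ℝ) + 2 * k < 2 * R := by
    have hceil := Nat.ceil_lt_add_one (show 0 ≤ R by linarith)
    rcases Nat.eq_zero_or_pos k with hk₀ | hk₀
    · rw [hk₀, Nat.cast_zero, mul_zero, add_zero]
      rcases le_or_gt R 1 with hR₁ | hR₁
      · have : (⌈R⌉₊ : ℝ) ≤ 1 := Nat.cast_le_one.2 (Nat.ceil_le.2 (by rwa [Nat.cast_one]))
        linarith
      · linarith
    · have : (1 : ℝ) ≤ k := Nat.one_le_cast.2 hk₀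
      linarith
  obtain ⟨y, hy⟩ := h.exists_dist_eq x (⌈R⌉₊ + k)
  refine ⟨y, by rw [hy]; push_cast; linarith [(Nat.cast_nonneg k : (0 : ℝ) ≤ k)], fun z hz => ?_⟩
  have hyz : Γ.dist y z ≤ k := by
    have := Nat.lt_ceil.2 (mem_ball.1 hz)
    omega
  have hupper : Γ.dist x z ≤ ⌈R⌉₊ + 2 * k := by
    have := dist_triangle (Γ := Γ) x y z
    omega
  have hlower : ⌈R⌉₊ ≤ Γ.dist x z := by
    have := dist_triangle (Γ := Γ) x z y
    rw [dist_comm z y] at this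
    omega
  refine ⟨mem_ball.2 (lt_of_le_of_lt ?_ hfit), ?_⟩
  · exact_mod_cast hupper
  · rw [mem_ball, not_lt]
    exact Nat.ceil_le.1 hlower

theorem LocallyFinite.exists_ballVol_le_annulusVol [Infinite V] (h : Γ.LocallyFinite)
    (hVD : Γ.VolumeDoubling) :
    ∃ C : ℝ≥0, ∀ (x : V) (R : ℝ), 1 / 2 < R →
      Γ.ballVol x (2 * R) ≤ C * Γ.annulusVol x R (2 * R) := by
  obtain ⟨d, -, hd⟩ := hVD
  refine ⟨d.toNNReal ^ 4, fun x R hR => ?_⟩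
  obtain ⟨y, hxy, hy⟩ := h.exists_ball_subset_annulus x hR
  rw [ENNReal.coe_pow]
  calc Γ.ballVol x (2 * R) ≤ Γ.ballVol y (2 ^ 4 * (R / 4)) :=
        vol_mono (ball_subset_ball (by rw [dist_comm]; linarith))
    _ ≤ ENNReal.ofReal d ^ 4 * Γ.ballVol y (R / 4) :=
        ballVol_two_pow_mul_le (hd y) (by linarith) 4
    _ ≤ ENNReal.ofReal d ^ 4 * Γ.annulusVol x R (2 * R) := by
        gcongr
        exact vol_le_annulusVol (vol_ne_top (h.finite_ball x R)) (by linarith) hy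

end Volume

section ExitTimeBounds

variable {V : Type*} [Nontrivial V] {Γ : WeightedGraph V} {D : Set V} {x : V}

theorem DirichletDomain.ofReal_green_le_add (hD : Γ.DirichletDomain D) {D' : Set V}
    (hD' : D' ⊆ D) {b : ℝ≥0∞} (hb : ∀ z ∉ D', ENNReal.ofReal (Γ.green D x z) ≤ b) (z : V) :
    ENNReal.ofReal (Γ.green D x z) ≤ ENNReal.ofReal (Γ.green D' x z) + b := by
  rcases eq_or_ne b ⊤ with rfl | hb_top
  · rw [add_top]
    exact le_top
  · have hb' : ∀ z ∉ D', Γ.green D x z ≤ b.toReal := fun z hz =>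
      (ENNReal.ofReal_le_iff_le_toReal hb_top).1 (hb z hz)
    rw [← ENNReal.ofReal_toReal hb_top]
    exact (ENNReal.ofReal_le_ofReal (hD.green_le_green_add hD' hb' z)).trans ENNReal.ofReal_add_le

variable [Countable V] [MeasurableSpace V] [DiscreteMeasurableSpace V]

theorem DirichletDomain.mul_vol_le_meanExit (hD : Γ.DirichletDomain D) {B : Set V} {a c : ℝ≥0∞}
    (ha : ∀ z ∈ B, a ≤ c * ENNReal.ofReal (Γ.green D x z)) :
    a * Γ.vol B ≤ c * Γ.meanExit x D := by
  rw [hD.meanExit_eq_tsum, vol, ← ENNReal.tsum_mul_left, ← ENNReal.tsum_mul_left]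
  simp only [← mul_assoc]
  calc ∑' z : B, a * ENNReal.ofReal (Γ.mu z)
      ≤ ∑' z : B, c * ENNReal.ofReal (Γ.green D x z) * ENNReal.ofReal (Γ.mu z) :=
        ENNReal.tsum_le_tsum fun z => mul_le_mul_left (ha z z.2) _
    _ ≤ ∑' z, c * ENNReal.ofReal (Γ.green D x z) * ENNReal.ofReal (Γ.mu z) :=
        ENNReal.tsum_comp_le_tsum_of_injective Subtype.val_injective
          fun z => c * ENNReal.ofReal (Γ.green D x z) * ENNReal.ofReal (Γ.mu z)

theorem DirichletDomain.meanExit_le_add (hD : Γ.DirichletDomain D) {D' : Set V} (hD' : D' ⊆ D)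
    {b : ℝ≥0∞} (hb : ∀ z ∉ D', ENNReal.ofReal (Γ.green D x z) ≤ b) :
    Γ.meanExit x D ≤ Γ.meanExit x D' + b * Γ.vol D := by
  have hvol : b * Γ.vol D = ∑' z, b * D.indicator (fun z => ENNReal.ofReal (Γ.mu z)) z := by
    rw [ENNReal.tsum_mul_left, ← tsum_subtype, vol]
  rw [hD.meanExit_eq_tsum, (hD.mono hD').meanExit_eq_tsum, hvol, ← ENNReal.tsum_add]
  refine ENNReal.tsum_le_tsum fun z => ?_
  by_cases hz : z ∈ D
  · rw [Set.indicator_of_mem hz, ← add_mul]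
    exact mul_le_mul_left (hD.ofReal_green_le_add hD' hb z) _
  · rw [hD.green_eq_zero x hz, ENNReal.ofReal_zero, zero_mul]
    exact zero_le

end ExitTimeBounds

section ResistanceBounds

variable {V : Type*} [Infinite V] {Γ : WeightedGraph V}

theorem CondP0.exists_annulusRes_le_green (hp₀ : Γ.CondP0) (hH : Γ.EllipticHarnack) :
    ∃ C : ℝ≥0, ∀ (x : V) (R : ℝ), 1 / 2 < R → ∀ z ∈ Γ.ball x R,
      Γ.annulusRes x R (2 * R) ≤ C * ENNReal.ofReal (Γ.green (Γ.ball x (2 * R)) x z) := by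
  obtain ⟨C, hC, hgreen⟩ := hp₀.exists_green_le_of_ellipticHarnack hH one_pos le_rfl
  refine ⟨C.toNNReal, fun x R hR z hz => ?_⟩
  have hpos : 0 < Γ.green (Γ.ball x (2 * R)) x z :=
    hp₀.green_pos (ball_mono x (by linarith) hz)
  refine ((hp₀.locallyFinite.dirichletDomain_ball x (2 * R)).resistance_le_ofReal
    (mem_ball_self (by linarith)) (mem_ball_self (by linarith)) (mul_pos hC hpos)
    fun a b hab hb => ?_).trans_eq (ENNReal.ofReal_mul hC.le)
  have hRb : R ≤ Γ.dist x b := not_lt.1 hb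
  have hba : (Γ.dist x b : ℝ) ≤ Γ.dist x a + 1 := by exact_mod_cast hab.dist_le_succ x
  exact ⟨hgreen x R hR a (by linarith) z hz, hgreen x R hR b (by linarith) z hz⟩

theorem CondP0.exists_green_le_annulusRes (hp₀ : Γ.CondP0) (hH : Γ.EllipticHarnack) {ε : ℝ}
    (hε : 0 < ε) (hε₁ : ε ≤ 1) :
    ∃ C : ℝ≥0, ∀ (x : V) (R : ℝ), 1 / 2 < R → ∀ y, ε * R ≤ Γ.dist x y + 1 →
      ENNReal.ofReal (Γ.green (Γ.ball x (2 * R)) x y) ≤ C * Γ.annulusRes x R (2 * R) := by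
  obtain ⟨C, hC, hgreen⟩ := hp₀.exists_green_le_of_ellipticHarnack hH hε hε₁
  refine ⟨C.toNNReal, fun x R hR y hy => ?_⟩
  have hlf := hp₀.locallyFinite
  obtain ⟨z, hz, hmin⟩ := Set.exists_min_image (Γ.ball x R) (Γ.green (Γ.ball x (2 * R)) x)
    (hlf.finite_ball x R) ⟨x, mem_ball_self (by linarith)⟩
  calc ENNReal.ofReal (Γ.green (Γ.ball x (2 * R)) x y)
      ≤ ENNReal.ofReal (C * Γ.green (Γ.ball x (2 * R)) x z) :=
        ENNReal.ofReal_le_ofReal (hgreen x R hR y hy z hz)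
    _ = C.toNNReal * ENNReal.ofReal (Γ.green (Γ.ball x (2 * R)) x z) := ENNReal.ofReal_mul hC.le
    _ ≤ C.toNNReal * Γ.annulusRes x R (2 * R) := by
        gcongr
        exact (hlf.dirichletDomain_ball x (2 * R)).ofReal_le_resistance
          (mem_ball_self (by linarith)) hmin

end ResistanceBounds

section EinsteinRelation

/-- The error terms of the iterated estimate `f R ≤ f (R / A) + M * g R` form a geometric series of
ratio `1 / 2`. -/
theorem le_two_mul_of_antidoubling {f g : ℝ → ℝ≥0∞} {A r : ℝ} {M : ℝ≥0∞} (hA : 1 < A) (hr : r ≤ 1)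
    (hsmall : ∀ R, r < R → R ≤ A → f R ≤ M * g R)
    (hlarge : ∀ R, A < R → f R ≤ f (R / A) + M * g R)
    (hanti : ∀ R, A < R → 2 * g (R / A) ≤ g R) {R : ℝ} (hR : r < R) : f R ≤ 2 * (M * g R) := by
  have hA₀ : 0 < A := one_pos.trans hA
  have hpow : ∀ (n : ℕ) (R : ℝ), r < R → R ≤ A ^ (n + 1) → f R ≤ 2 * (M * g R) := by
    intro n
    induction n with
    | zero =>
      intro R hR hRA
      rw [two_mul]
      exact (hsmall R hR (by simpa using hRA)).trans le_self_add
    | succ n ih =>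
      intro R hR hRA
      rcases le_or_gt R A with hle | hlt
      · rw [two_mul]
        exact (hsmall R hR hle).trans le_self_add
      · have hprev : f (R / A) ≤ 2 * (M * g (R / A)) :=
          ih (R / A) (hr.trans_lt ((one_lt_div hA₀).2 hlt)) ((div_le_iff₀ hA₀).2 hRA)
        calc f R ≤ f (R / A) + M * g R := hlarge R hlt
          _ ≤ M * (2 * g (R / A)) + M * g R := by
            gcongr
            exact hprev.trans_eq (mul_left_comm _ _ _)
          _ ≤ M * g R + M * g R := by gcongr; exact hanti R hlt
          _ = 2 * (M * g R) := (two_mul _).symm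
  obtain ⟨n, hn⟩ := pow_unbounded_of_one_lt R hA
  exact hpow n R hR (hn.le.trans (pow_le_pow_right₀ hA.le n.le_succ))

variable {V : Type*} {Γ : WeightedGraph V}

/-- The product `ρ(x, R, 2R) v(x, R, 2R)`, to which the mean exit time is compared. -/
noncomputable def resVol (Γ : WeightedGraph V) (x : V) (R : ℝ) : ℝ≥0∞ :=
  Γ.annulusRes x R (2 * R) * Γ.annulusVol x R (2 * R)

variable [Countable V] [Infinite V] [MeasurableSpace V] [DiscreteMeasurableSpace V]

theorem CondP0.exists_resVol_le_E (hp₀ : Γ.CondP0) (hVD : Γ.VolumeDoubling)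
    (hH : Γ.EllipticHarnack) :
    ∃ C : ℝ≥0, ∀ (x : V) (R : ℝ), 1 / 2 < R → Γ.resVol x R ≤ C * Γ.E x (2 * R) := by
  obtain ⟨C, hC⟩ := hp₀.exists_annulusRes_le_green hH
  obtain ⟨d, -, hd⟩ := hVD
  refine ⟨d.toNNReal * C, fun x R hR => ?_⟩
  have hE : Γ.annulusRes x R (2 * R) * Γ.ballVol x R ≤ C * Γ.E x (2 * R) :=
    (hp₀.locallyFinite.dirichletDomain_ball x (2 * R)).mul_vol_le_meanExit (hC x R hR)
  calc Γ.resVol x R ≤ Γ.annulusRes x R (2 * R) * (d.toNNReal * Γ.ballVol x R) :=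
        mul_le_mul_right (tsub_le_self.trans (hd x R (by linarith))) _
    _ = d.toNNReal * (Γ.annulusRes x R (2 * R) * Γ.ballVol x R) := mul_left_comm _ _ _
    _ ≤ (d.toNNReal * C : ℝ≥0) * Γ.E x (2 * R) := by
        rw [ENNReal.coe_mul, mul_assoc]
        gcongr

theorem LocallyFinite.E_zero (h : Γ.LocallyFinite) (x : V) : Γ.E x 0 = 0 := by
  have hx : x ∉ Γ.ball x 0 := by simp [mem_ball]
  have hD := h.dirichletDomain_ball x 0
  rw [E, hD.meanExit_eq_tsum]
  simp only [hD.green_eq_zero_left hx, ENNReal.ofReal_zero, zero_mul, tsum_zero]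

theorem CondP0.exists_E_le_add_resVol (hp₀ : Γ.CondP0) (hVD : Γ.VolumeDoubling)
    (hH : Γ.EllipticHarnack) {ε : ℝ} (hε : 0 < ε) (hε₁ : ε ≤ 1) :
    ∃ M : ℝ≥0, ∀ (x : V) (r R : ℝ), 1 / 2 < R → r ≤ 2 * R → ε * R ≤ r + 1 →
      Γ.E x (2 * R) ≤ Γ.E x r + M * Γ.resVol x R := by
  have hlf := hp₀.locallyFinite
  obtain ⟨C, hgreen⟩ := hp₀.exists_green_le_annulusRes hH hε hε₁
  obtain ⟨K, hvol⟩ := hlf.exists_ballVol_le_annulusVol hVD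
  refine ⟨C * K, fun x r R hR hrR hεR => ?_⟩
  calc Γ.E x (2 * R)
      ≤ Γ.E x r + C * Γ.annulusRes x R (2 * R) * Γ.ballVol x (2 * R) :=
        (hlf.dirichletDomain_ball x (2 * R)).meanExit_le_add (ball_mono x hrR) fun z hz => by
          have : r ≤ Γ.dist x z := not_lt.1 hz
          exact hgreen x R hR z (by linarith)
    _ ≤ Γ.E x r + C * Γ.annulusRes x R (2 * R) * (K * Γ.annulusVol x R (2 * R)) := by
        gcongr
        exact hvol x R hR
    _ = Γ.E x r + (C * K : ℝ≥0) * Γ.resVol x R := by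
        rw [resVol, ENNReal.coe_mul, mul_mul_mul_comm]

theorem CondP0.exists_E_le_resVol (hp₀ : Γ.CondP0) (hVD : Γ.VolumeDoubling)
    (hH : Γ.EllipticHarnack) (hρv : Γ.AntiDoublingResVol) :
    ∃ C : ℝ≥0, ∀ (x : V) (R : ℝ), 1 / 2 < R → Γ.E x (2 * R) ≤ C * Γ.resVol x R := by
  obtain ⟨A, hA, hanti⟩ := hρv
  have hA₀ : 0 < A := one_pos.trans hA
  obtain ⟨M, hM⟩ := hp₀.exists_E_le_add_resVol hVD hH (inv_pos.2 hA₀) (inv_le_one_of_one_le₀ hA.le)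
  refine ⟨2 * M, fun x R hR => ?_⟩
  rw [ENNReal.coe_mul, ENNReal.coe_ofNat, mul_assoc]
  refine le_two_mul_of_antidoubling (f := fun R => Γ.E x (2 * R)) (g := Γ.resVol x) hA
    (by norm_num : (1 / 2 : ℝ) ≤ 1) (fun R hR hRA => ?_) (fun R hRA => ?_) (fun R hRA => ?_) hR
  · have hεR : A⁻¹ * R ≤ 0 + 1 := by rwa [zero_add, inv_mul_le_iff₀ hA₀, mul_one]
    simpa only [hp₀.locallyFinite.E_zero, zero_add] using hM x 0 R hR (by linarith) hεR
  · have hpos : 0 < R / A := div_pos (hA₀.trans hRA) hA₀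
    have hle : R / A ≤ R := div_le_self (hA₀.trans hRA).le hA.le
    exact hM x (2 * (R / A)) R (by linarith) (by linarith) (by rw [← div_eq_inv_mul]; linarith)
  · simpa only [resVol, mul_div_cancel₀ R hA₀.ne'] using
      hanti x (R / A) (div_pos (hA₀.trans hRA) hA₀)

end EinsteinRelation

end WeightedGraph

theorem mainTheorem4 {V : Type*} [Countable V] [Infinite V]
    [MeasurableSpace V] [DiscreteMeasurableSpace V] (Γ : WeightedGraph V)
    (hp0 : Γ.CondP0) (hVD : Γ.VolumeDoubling) (hH : Γ.EllipticHarnack)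
    (hρv : Γ.AntiDoublingResVol) :
    ∃ C : ℝ, 1 < C ∧ ∀ (x : V) (R : ℝ), 1 / 2 < R →
      (ENNReal.ofReal C)⁻¹ * Γ.E x (2 * R) ≤
          Γ.annulusRes x R (2 * R) * Γ.annulusVol x R (2 * R) ∧
        Γ.annulusRes x R (2 * R) * Γ.annulusVol x R (2 * R) ≤
          ENNReal.ofReal C * Γ.E x (2 * R) := by
  obtain ⟨C₁, h₁⟩ := hp0.exists_resVol_le_E hVD hH
  obtain ⟨C₂, h₂⟩ := hp0.exists_E_le_resVol hVD hH hρv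
  have hC : (0 : ℝ) ≤ C₁ ∧ (0 : ℝ) ≤ C₂ := ⟨C₁.coe_nonneg, C₂.coe_nonneg⟩
  have hle₁ : (C₁ : ℝ≥0∞) ≤ ENNReal.ofReal (C₁ + C₂ + 2) :=
    ENNReal.ofReal_coe_nnreal.ge.trans (ENNReal.ofReal_le_ofReal (by linarith [hC.2]))
  have hle₂ : (C₂ : ℝ≥0∞) ≤ ENNReal.ofReal (C₁ + C₂ + 2) :=
    ENNReal.ofReal_coe_nnreal.ge.trans (ENNReal.ofReal_le_ofReal (by linarith [hC.1]))
  have hne : ENNReal.ofReal (C₁ + C₂ + 2) ≠ 0 :=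
    (ENNReal.ofReal_pos.2 (by linarith [hC.1, hC.2])).ne'
  refine ⟨C₁ + C₂ + 2, by linarith [hC.1, hC.2], fun x R hR => ⟨?_, ?_⟩⟩
  · rw [ENNReal.inv_mul_le_iff hne ENNReal.ofReal_ne_top]
    exact (h₂ x R hR).trans (mul_le_mul_left hle₂ _)
  · exact (h₁ x R hR).trans (mul_le_mul_left hle₁ _)
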